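/- Let $X$ be an infinite, connected, locally finite graph, possibly with multiple edges and loops (a loop at $x$ counts twice in the degree $\deg(x)$), such that $\deg(x)\ge 2$ for all vertices $x$. An automorphism of $X$ is a bijection $g$ of the vertex set such that $e(gx,gy)=e(x,y)$ for all $x,y$, where $e(x,y)$ is the number of edges between $x$ and $y$ if $x\neq y$, and $e(x,x)$ is twice the number of loops at $x$. Suppose that $X$ is almost transitive, that is, the automorphism group acts on the vertex set with finitely many orbits. Each edge (each loop included) is regarded as a pair of oppositely oriented edges $e,\check e$, where $e$ goes from $e^-$ to $e^+$ and $\check e$ from $e^+$ to $e^-$. Non-backtracking random walk started at a vertex $x$ chooses its first oriented edge uniformly among those going out of $x$; after traversing an oriented edge $e$, it chooses the next one uniformly among the $\deg(e^+)-1$ oriented edges $f\ne\check e$ with $f^-=e^+$. Let $q^{(n)}(x,y)$ be the probability that the walk started at $x$ is at $y$ at the $n$-th step. Then $$\rho(Q)=\limsup_{n\to\infty} q^{(n)}(x,y)^{1/n}$$ does not depend on the vertices $x,y$, and the following holds. If $X$ is not a tree (a tree being a connected graph without cycles; loops and pairs of parallel edges count as cycles), then $\rho(Q)>0$ and $$\lim_{n\to\infty}\frac{q^{(n)}(x,y)}{\rho(Q)^n}=0\qquad\text{for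 all vertices } x,y.$$ If $X$ is a tree, then $\rho(Q)=0$ and, for all vertices $x,y$, $q^{(n)}(x,y)=0$ for all sufficiently large $n$ (so the same limit relation holds with the convention $0/0=0$). -/

import Mathlib

open Filter Topology

/-- A locally finite graph, possibly with multiple edges and loops, with vertex set `V` and set of
oriented edges `E`. Every unoriented edge (in particular, every loop) corresponds to exactly two
oriented edges `e` and `rev e`; `src e` is the initial vertex of `e`. -/
structure LFGraph (V : Type*) (E : Type*) where
  src : E → V
  rev : E → E
  rev_rev : ∀ e, rev (rev e) = e
  rev_ne : ∀ e, rev e ≠ e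
  finite_src : ∀ x, {e | src e = x}.Finite

namespace LFGraph

variable {V E : Type*} (G : LFGraph V E)

/-- The terminal vertex of an oriented edge. -/
def tgt (e : E) : V := G.src (G.rev e)

theorem finite_tgt (y : V) : {e | G.tgt e = y}.Finite :=
  (G.finite_src y).preimage (Function.LeftInverse.injective G.rev_rev).injOn

/-- The oriented edges with initial vertex `x`. -/
noncomputable def outEdges (x : V) : Finset E := (G.finite_src x).toFinset

/-- The oriented edges with terminal vertex `y`. -/
noncomputable def inEdges (y : V) : Finset E := (G.finite_tgt y).toFinset

/-- The degree; a loop at `x` contributes two. -/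
noncomputable def deg (x : V) : ℕ := (G.outEdges x).card

/-- The number of edges between `x` and `y` if `x ≠ y`, and twice the number of loops at `x`
if `x = y`. -/
noncomputable def mult (x y : V) : ℕ := {e | G.src e = x ∧ G.tgt e = y}.ncard

def Adj (x y : V) : Prop := ∃ e, G.src e = x ∧ G.tgt e = y

/-- Any two vertices are joined by a finite path. -/
def Connected : Prop := Nonempty V ∧ ∀ x y, Relation.ReflTransGen G.Adj x y

/-- The automorphism group: the bijections of the vertex set that preserve all edge
multiplicities. -/
def autGroup : Subgroup (Equiv.Perm V) where
  carrier := {g | ∀ x y, G.mult (g x) (g y) = G.mult x y}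
  one_mem' := fun _ _ => rfl
  mul_mem' := fun {a b} ha hb x y => (ha (b x) (b y)).trans (hb x y)
  inv_mem' := fun {a} ha x y => by
    have h := ha (a⁻¹ x) (a⁻¹ y)
    simpa using h.symm

/-- The automorphism group acts with finitely many orbits on the vertex set. -/
def AlmostTransitive : Prop := Finite (MulAction.orbitRel.Quotient G.autGroup V)

/-- The edge `f` is a possible non-backtracking continuation of `e`. -/
def Follows (e f : E) : Prop := G.src f = G.tgt e ∧ f ≠ G.rev e

/-- `e 0, …, e (n - 1)` is a cycle of length `n ≥ 1`: the initial vertices are distinct, and each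
edge is a non-backtracking continuation of the previous one, cyclically. A loop is a cycle of
length 1 and a pair of parallel edges gives a cycle of length 2. -/
def IsCycle (n : ℕ) (e : ℕ → E) : Prop :=
  0 < n ∧ e n = e 0 ∧ Set.InjOn (fun k => G.src (e k)) (Set.Iio n) ∧
    ∀ k < n, G.Follows (e k) (e (k + 1))

/-- A tree is a connected graph without cycles (hence without loops and multiple edges). -/
def IsTree : Prop := G.Connected ∧ ∀ n e, ¬ G.IsCycle n e

open Classical in
/-- The transition matrix of the non-backtracking random walk on the oriented edges. -/
noncomputable def qE (e f : E) : ℝ :=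
  if G.Follows e f then 1 / ((G.deg (G.tgt e) : ℝ) - 1) else 0

open Classical in
/-- The `n`-step transition probabilities on the oriented edges, that is, the entries of the
`n`-th power of the matrix `qE`. All the sums have only finitely many nonzero terms. -/
noncomputable def qEStep : ℕ → E → E → ℝ
  | 0, e, f => if e = f then 1 else 0
  | n + 1, e, f => ∑' g, G.qE e g * qEStep n g f

open Classical in
/-- The probability that the non-backtracking random walk started at the vertex `x` is at the
vertex `y` at the `n`-th step: the first edge is uniformly distributed on the edges going out
of `x`, and each of the remaining `n - 1` steps is made according to `qE`. -/
noncomputable def q : ℕ → V → V → ℝ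
  | 0, x, y => if x = y then 1 else 0
  | n + 1, x, y =>
      ∑ e ∈ G.outEdges x, ∑ f ∈ G.inEdges y, 1 / (G.deg x : ℝ) * G.qEStep n e f

/-- The exponential rate `limsup q⁽ⁿ⁾(x,y)^(1/n)`. -/
noncomputable def rate (x y : V) : ℝ :=
  limsup (fun n : ℕ => G.q n x y ^ (1 / (n : ℝ))) atTop

end LFGraph

/-! On a tree, two vertices are joined by only one non-backtracking path, because two such paths
would close up to a cycle. Hence `q` is nonzero for at most one positive time, and the rate is 0.

Off trees, the walk is a Markov chain on oriented edges with the row-finite matrix `qE`. Two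
properties of this chain give the theorem.

Irreducibility (`edgeMatrix_irreducible`). Suppose `e` cannot be turned around. Then the edges
reachable from `e` branch out without ever merging, and a closed path among them must pass through
`e`. Almost transitivity puts a cycle within bounded distance of every vertex, so this set is
finite, and then so is the whole graph.

Many equivalent states (`exists_infinite_edge_orbit`). Finitely many orbits on infinitely many
vertices leave one infinite orbit. Since automorphisms lift to edges, infinitely many edges have the
same return sequence.

An irreducible matrix with infinitely many equivalent diagonal entries is ρ-null
(`exists_spectral_radius`). After rescaling by the spectral radius, the return weights are at most
1. If they are summable, they tend to 0. Otherwise the matrix is recurrent and has a positive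
harmonic function (`exists_harmonic`). A renewal sequence that does not tend to 0 has positive
density (`renewal_density`), and the total mass of the harmonic function allows only finitely many
states with a common positive density (`finite_of_density`). -/

/-! ### Bounded renewal sequences -/

/-- Here `f k` is the weight of a gap of length `k + 1`. If the gaps had total weight above 1, the
partial sums of `u` would grow geometrically, whereas `u ≤ 1` allows only linear growth. -/
theorem renewal_partial_sum_le_one {u f : ℕ → ℝ} (hu0 : u 0 = 1) (hu : ∀ n, 0 ≤ u n)
    (hu1 : ∀ n, u n ≤ 1) (hf : ∀ n, 0 ≤ f n)
    (hrec : ∀ n, u (n + 1) = ∑ k ∈ Finset.range (n + 1), f k * u (n - k)) (K : ℕ) :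
    ∑ k ∈ Finset.range K, f k ≤ 1 := by
  by_contra hlt
  push Not at hlt
  set F := ∑ k ∈ Finset.range K, f k with hF
  let S : ℕ → ℝ := fun N => ∑ n ∈ Finset.range N, u n
  have hSmono : Monotone S := fun a b hab =>
    Finset.sum_le_sum_of_subset_of_nonneg (Finset.range_mono hab) fun _ _ _ => hu _
  have hstep : ∀ N, F * S N ≤ S (N + K) := by
    intro N
    have hterm : ∀ m, ∑ k ∈ Finset.range K, f k * (if k ≤ m then u (m - k) else 0) ≤ u (m + 1) := by
      intro m
      rw [hrec m]
      calc _ = ∑ k ∈ (Finset.range K).filter (· ≤ m), f k * u (m - k) := by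
            rw [Finset.sum_filter]
            exact Finset.sum_congr rfl fun k _ => by split_ifs <;> simp
        _ ≤ _ := by
            refine Finset.sum_le_sum_of_subset_of_nonneg ?_ fun i _ _ => mul_nonneg (hf _) (hu _)
            intro k hk
            simp only [Finset.mem_filter, Finset.mem_range] at hk ⊢
            omega
    have hshift : ∀ k < K, S N ≤ ∑ m ∈ Finset.range (N + K - 1), (if k ≤ m then u (m - k) else 0) := by
      intro k hk
      calc S N = ∑ m ∈ (Finset.range N).map (addRightEmbedding k),
            (if k ≤ m then u (m - k) else 0) := by simp [S, Finset.sum_map]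
        _ ≤ _ := by
            refine Finset.sum_le_sum_of_subset_of_nonneg ?_ fun i _ _ => by
              split_ifs
              exacts [hu _, le_rfl]
            intro m hm
            simp only [Finset.mem_map, Finset.mem_range, addRightEmbedding_apply] at hm ⊢
            omega
    calc F * S N = ∑ k ∈ Finset.range K, f k * S N := by rw [hF, Finset.sum_mul]
      _ ≤ ∑ k ∈ Finset.range K, f k *
            ∑ m ∈ Finset.range (N + K - 1), (if k ≤ m then u (m - k) else 0) :=
          Finset.sum_le_sum fun k hk =>
            mul_le_mul_of_nonneg_left (hshift k (Finset.mem_range.1 hk)) (hf k)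
      _ = ∑ m ∈ Finset.range (N + K - 1), ∑ k ∈ Finset.range K,
            f k * (if k ≤ m then u (m - k) else 0) := by
          simp_rw [Finset.mul_sum]
          exact Finset.sum_comm
      _ ≤ ∑ m ∈ Finset.range (N + K - 1), u (m + 1) := Finset.sum_le_sum fun m _ => hterm m
      _ ≤ S (N + K - 1 + 1) := by
          simp only [S]
          rw [Finset.sum_range_succ' u]
          linarith [hu 0]
      _ ≤ S (N + K) := by
          rcases Nat.eq_zero_or_pos K with rfl | hK
          · simp at hF
            linarith
          · exact hSmono (by omega)
  have hgrow : ∀ j : ℕ, F ^ j ≤ S (1 + j * K) := by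
    intro j
    induction j with
    | zero => simp [S, hu0]
    | succ j ih =>
      calc F ^ (j + 1) = F * F ^ j := by ring
        _ ≤ F * S (1 + j * K) := mul_le_mul_of_nonneg_left ih (by linarith)
        _ ≤ S (1 + j * K + K) := hstep _
        _ = _ := by congr 1; ring
  have hlin : ∀ N, S N ≤ N := by
    intro N
    calc S N ≤ ∑ n ∈ Finset.range N, (1 : ℝ) := Finset.sum_le_sum fun n _ => hu1 n
      _ = N := by simp
  have h1 : Tendsto (fun j : ℕ => (j : ℝ) ^ 1 / F ^ j) atTop (𝓝 0) :=
    tendsto_pow_const_div_const_pow_of_one_lt 1 hlt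
  have h0 : Tendsto (fun j : ℕ => (j : ℝ) ^ 0 / F ^ j) atTop (𝓝 0) :=
    tendsto_pow_const_div_const_pow_of_one_lt 0 hlt
  have h2 := h0.add (h1.const_mul (K : ℝ))
  simp only [mul_zero, add_zero] at h2
  refine absurd (ge_of_tendsto' (b := (1 : ℝ)) h2 fun j => ?_) (by norm_num)
  have hpos : 0 < F ^ j := pow_pos (by linarith) j
  have := (hgrow j).trans (hlin _)
  push_cast at this
  rw [pow_zero, pow_one, ← mul_div_assoc, ← add_div, le_div_iff₀ hpos]
  linarith

/-- Decomposition by the last renewal up to time `n`: it happened `j` steps ago, and the next gap is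
longer than `j`. -/
theorem renewal_identity {u f : ℕ → ℝ} (hu0 : u 0 = 1)
    (hrec : ∀ n, u (n + 1) = ∑ k ∈ Finset.range (n + 1), f k * u (n - k)) (n : ℕ) :
    ∑ j ∈ Finset.range (n + 1), (1 - ∑ k ∈ Finset.range j, f k) * u (n - j) = 1 := by
  induction n with
  | zero => simp [hu0]
  | succ n ih =>
    rw [Finset.sum_range_succ']
    have e : ∀ j ∈ Finset.range (n + 1),
        (1 - ∑ k ∈ Finset.range (j + 1), f k) * u (n + 1 - (j + 1)) =
        (1 - ∑ k ∈ Finset.range j, f k) * u (n - j) - f j * u (n - j) := fun j _ => by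
      rw [Finset.sum_range_succ, Nat.add_sub_add_right]
      ring
    rw [Finset.sum_congr rfl e, Finset.sum_sub_distrib, ih]
    simp [hrec n]

/-- An ultrafilter replaces a diagonal subsequence: along it, all the shifts of `u` converge as
well. -/
theorem exists_ultrafilter_tendsto_limsup {u : ℕ → ℝ} (hu : ∀ n, 0 ≤ u n) (hu1 : ∀ n, u n ≤ 1) :
    ∃ U : Ultrafilter ℕ, (U : Filter ℕ) ≤ atTop ∧ Tendsto u U (𝓝 (limsup u atTop)) := by
  have hb : IsBoundedUnder (· ≤ ·) atTop u := isBoundedUnder_of ⟨1, hu1⟩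
  have hc : IsCoboundedUnder (· ≤ ·) atTop u :=
    (isBoundedUnder_of ⟨0, hu⟩ : IsBoundedUnder (· ≥ ·) atTop u).isCoboundedUnder_le
  have : MapClusterPt (limsup u atTop) atTop u := by
    rw [mapClusterPt_iff_frequently]
    intro s hs
    obtain ⟨ε, hε, hs⟩ := Metric.mem_nhds_iff.1 hs
    have h1 : ∃ᶠ n in atTop, limsup u atTop - ε < u n :=
      frequently_lt_of_lt_limsup hc (by linarith)
    have h2 : ∀ᶠ n in atTop, u n < limsup u atTop + ε :=
      eventually_lt_of_limsup_lt (by linarith) hb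
    refine (h1.and_eventually h2).mono fun n hn => hs ?_
    rw [Metric.mem_ball, Real.dist_eq, abs_lt]
    constructor <;> linarith [hn.1, hn.2]
  exact mapClusterPt_iff_ultrafilter.1 this

theorem exists_ultrafilter_limit (U : Ultrafilter ℕ) {v : ℕ → ℝ} {C : ℝ} (h0 : ∀ n, 0 ≤ v n)
    (h1 : ∀ n, v n ≤ C) : ∃ w ∈ Set.Icc 0 C, Tendsto v U (𝓝 w) := by
  obtain ⟨w, hw, h⟩ := (isCompact_Icc (a := (0 : ℝ)) (b := C)).ultrafilter_le_nhds' (U.map v)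
    (Filter.Eventually.of_forall fun n => ⟨h0 n, h1 n⟩ : ∀ᶠ n in U, v n ∈ Set.Icc 0 C)
  exact ⟨w, hw, h⟩

/-- A bounded renewal sequence that does not tend to zero has positive lower density. -/
theorem renewal_density {u f : ℕ → ℝ} (hu0 : u 0 = 1) (hu : ∀ n, 0 ≤ u n)
    (hu1 : ∀ n, u n ≤ 1) (hf : ∀ n, 0 ≤ f n)
    (hrec : ∀ n, u (n + 1) = ∑ k ∈ Finset.range (n + 1), f k * u (n - k))
    {k₀ : ℕ} (hk₀ : 0 < f k₀) (hlim : ¬ Tendsto u atTop (𝓝 0)) :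
    ∃ δ > 0, ∀ N : ℕ, δ * N ≤ ∑ n ∈ Finset.range N, u n := by
  have hF := renewal_partial_sum_le_one hu0 hu hu1 hf hrec
  have hfs : Summable f := summable_of_sum_range_le hf hF
  obtain ⟨U, hU, hUlim⟩ := exists_ultrafilter_tendsto_limsup hu hu1
  set lam := limsup u atTop
  have hb : IsBoundedUnder (· ≤ ·) atTop u := isBoundedUnder_of ⟨1, hu1⟩
  have hlam0 : 0 < lam := by
    by_contra hle
    refine hlim (tendsto_order.2 ⟨fun a ha => Eventually.of_forall fun n => ha.trans_le (hu n),
      fun a ha => eventually_lt_of_limsup_lt (by linarith) hb⟩)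
  have hex : ∀ j, ∃ w, Tendsto (fun n => u (n - j)) U (𝓝 w) := fun j =>
    let ⟨w, _, h⟩ := exists_ultrafilter_limit U (fun n => hu (n - j)) (fun n => hu1 (n - j))
    ⟨w, h⟩
  choose w hw using hex
  have hw0 : w 0 = lam := tendsto_nhds_unique (hw 0) hUlim
  have hwle : ∀ j, w j ≤ lam := by
    intro j
    refine le_of_forall_pos_le_add fun ε hε => le_of_tendsto (hw j) (hU ?_)
    have h := (tendsto_sub_atTop_nat j).eventually
      (eventually_lt_of_limsup_lt (show limsup u atTop < lam + ε by linarith) hb)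
    exact h.mono fun n hn => le_of_lt hn
  -- Maximum principle: by the recursion, `w j` is at most an average, of total weight at most 1, of
  -- values not exceeding `lam`. If `w j = lam`, the values with positive weight must equal `lam`.
  have hwstep : ∀ j, w j = lam → w (j + (k₀ + 1)) = lam := by
    intro j hj
    refine le_antisymm (hwle _) ?_
    -- The number of terms in the recursion grows with `n`, so it is cut at `K` before the limit is
    -- taken. As `u ≤ 1`, the remainder is at most the tail of `∑ f`.
    have key : ∀ K > k₀, lam ≤ f k₀ * w (j + (k₀ + 1)) + (1 - f k₀) * lam
        + (∑' k, f k - ∑ k ∈ Finset.range K, f k) := by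
      intro K hK
      have h1 : ∀ᶠ n in (U : Filter ℕ), u (n - j) ≤
          ∑ k ∈ Finset.range K, f k * u (n - (j + (k + 1))) +
            (∑' k, f k - ∑ k ∈ Finset.range K, f k) := by
        refine hU ((eventually_ge_atTop (j + K + 1)).mono fun n hn => ?_)
        obtain ⟨m, hm⟩ : ∃ m, n - j = m + 1 := ⟨n - j - 1, by omega⟩
        rw [hm, hrec m, ← Finset.sum_range_add_sum_Ico _ (show K ≤ m + 1 by omega)]
        refine add_le_add (le_of_eq (Finset.sum_congr rfl fun k _ => ?_)) ?_
        · congr 2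
          omega
        · have h2 : ∑ k ∈ Finset.Ico K (m + 1), f k * u (m - k) ≤ ∑ k ∈ Finset.Ico K (m + 1), f k :=
            Finset.sum_le_sum fun k _ => mul_le_of_le_one_right (hf k) (hu1 _)
          have h3 := Finset.sum_range_add_sum_Ico f (show K ≤ m + 1 by omega)
          have h4 := hfs.sum_le_tsum (Finset.range (m + 1)) fun k _ => hf k
          linarith
      have h5 : Tendsto (fun n => ∑ k ∈ Finset.range K, f k * u (n - (j + (k + 1))) +
            (∑' k, f k - ∑ k ∈ Finset.range K, f k)) U
          (𝓝 (∑ k ∈ Finset.range K, f k * w (j + (k + 1)) +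
            (∑' k, f k - ∑ k ∈ Finset.range K, f k))) :=
        (tendsto_finsetSum _ fun k _ => (hw _).const_mul _).add_const _
      have h6 := le_of_tendsto_of_tendsto (hw j) h5 h1
      rw [hj] at h6
      refine h6.trans (add_le_add_left ?_ _)
      have hmem : k₀ ∈ Finset.range K := Finset.mem_range.2 hK
      rw [← Finset.add_sum_erase _ _ hmem]
      refine add_le_add_right ?_ _
      calc _ ≤ ∑ k ∈ (Finset.range K).erase k₀, f k * lam :=
            Finset.sum_le_sum fun k _ => mul_le_mul_of_nonneg_left (hwle _) (hf k)
        _ = (∑ k ∈ (Finset.range K).erase k₀, f k) * lam := by rw [Finset.sum_mul]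
        _ ≤ _ := by
          refine mul_le_mul_of_nonneg_right ?_ hlam0.le
          have := Finset.add_sum_erase _ f hmem
          linarith [hF K]
    have hlimK : Tendsto (fun K => f k₀ * w (j + (k₀ + 1)) + (1 - f k₀) * lam
        + (∑' k, f k - ∑ k ∈ Finset.range K, f k)) atTop
        (𝓝 (f k₀ * w (j + (k₀ + 1)) + (1 - f k₀) * lam + (∑' k, f k - ∑' k, f k))) :=
      ((hfs.hasSum.tendsto_sum_nat).const_sub _).const_add _
    have := ge_of_tendsto hlimK ((eventually_gt_atTop k₀).mono key)
    rw [sub_self, add_zero] at this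
    have h7 : f k₀ * lam ≤ f k₀ * w (j + (k₀ + 1)) := by linarith
    exact le_of_mul_le_mul_left h7 hk₀
  have hws : ∀ i : ℕ, w (i * (k₀ + 1)) = lam := by
    intro i
    induction i with
    | zero => simpa using hw0
    | succ i ih => rw [Nat.succ_mul]; exact hwstep _ ih
  let r : ℕ → ℝ := fun j => 1 - ∑ k ∈ Finset.range j, f k
  have hr0 : ∀ j, 0 ≤ r j := fun j => sub_nonneg.2 (hF j)
  have hranti : Antitone r := fun a b hab => sub_le_sub_left
    (Finset.sum_le_sum_of_subset_of_nonneg (Finset.range_mono hab) fun _ _ _ => hf _) _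
  have hid := renewal_identity hu0 hrec
  -- Only the multiples of `k₀ + 1` are kept in the renewal identity, since there the limits are
  -- known to be `lam`. No aperiodicity is needed; monotonicity of `r` fills the gaps in `hblock`,
  -- so the mean gap is finite.
  have hsum1 : ∀ I : ℕ, (∑ i ∈ Finset.range I, r (i * (k₀ + 1))) * lam ≤ 1 := by
    intro I
    have h1 : Tendsto (fun n => ∑ i ∈ Finset.range I, r (i * (k₀ + 1)) * u (n - i * (k₀ + 1))) U
        (𝓝 (∑ i ∈ Finset.range I, r (i * (k₀ + 1)) * w (i * (k₀ + 1)))) :=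
      tendsto_finsetSum _ fun k _ => (hw _).const_mul _
    simp_rw [hws, ← Finset.sum_mul] at h1
    refine le_of_tendsto h1 (hU ((eventually_ge_atTop (I * (k₀ + 1))).mono fun n hn => ?_))
    rw [← hid n]
    have hinj : Set.InjOn (fun i => i * (k₀ + 1)) (Finset.range I) :=
      fun a _ b _ h => Nat.eq_of_mul_eq_mul_right (Nat.succ_pos k₀) h
    rw [← Finset.sum_image (f := fun j => r j * u (n - j)) hinj]
    refine Finset.sum_le_sum_of_subset_of_nonneg ?_ fun j _ _ => mul_nonneg (hr0 j) (hu _)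
    intro j hj
    simp only [Finset.mem_image, Finset.mem_range] at hj ⊢
    obtain ⟨i, hi, rfl⟩ := hj
    have := Nat.mul_le_mul_right (k₀ + 1) hi.le
    omega
  have hblock : ∀ I : ℕ, ∑ j ∈ Finset.range (I * (k₀ + 1)), r j ≤
      (k₀ + 1) * ∑ i ∈ Finset.range I, r (i * (k₀ + 1)) := by
    intro I
    induction I with
    | zero => simp
    | succ I ih =>
      rw [Nat.succ_mul, Finset.sum_range_add, Finset.sum_range_succ _ I, mul_add ((k₀ : ℝ) + 1)]
      refine add_le_add ih ?_
      calc _ ≤ ∑ x ∈ Finset.range (k₀ + 1), r (I * (k₀ + 1)) :=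
            Finset.sum_le_sum fun x _ => hranti (Nat.le_add_right _ _)
        _ = _ := by simp
  have hR : ∀ N, ∑ j ∈ Finset.range N, r j ≤ (k₀ + 1) / lam := by
    intro N
    have h1 : ∑ j ∈ Finset.range N, r j ≤ ∑ j ∈ Finset.range (N * (k₀ + 1)), r j :=
      Finset.sum_le_sum_of_subset_of_nonneg
        (Finset.range_mono (Nat.le_mul_of_pos_right _ (Nat.succ_pos _))) fun _ _ _ => hr0 _
    refine h1.trans ((hblock N).trans ?_)
    rw [le_div_iff₀ hlam0, mul_assoc]
    exact mul_le_of_le_one_right (by positivity) (hsum1 N)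
  refine ⟨lam / (k₀ + 1), by positivity, fun N => ?_⟩
  -- The renewal identity summed over `n < N`.
  have h1 : (N : ℝ) ≤ (∑ j ∈ Finset.range N, r j) * ∑ n ∈ Finset.range N, u n := by
    calc (N : ℝ) = ∑ n ∈ Finset.range N, ∑ j ∈ Finset.range (n + 1), r j * u (n - j) := by
          simp [r, hid]
      _ = ∑ j ∈ Finset.range N, ∑ m ∈ Finset.range (N - j), r j * u m :=
          Finset.sum_range_diag_flip N fun j m => r j * u m
      _ ≤ ∑ j ∈ Finset.range N, ∑ m ∈ Finset.range N, r j * u m :=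
          Finset.sum_le_sum fun j _ => Finset.sum_le_sum_of_subset_of_nonneg
            (Finset.range_mono (Nat.sub_le _ _)) fun m _ _ => mul_nonneg (hr0 j) (hu m)
      _ = _ := (Finset.sum_mul_sum _ _ _ _).symm
  have h2 : 0 ≤ ∑ n ∈ Finset.range N, u n := Finset.sum_nonneg fun n _ => hu n
  have h3 := h1.trans (mul_le_mul_of_nonneg_right (hR N) h2)
  rw [div_mul_eq_mul_div, le_div_iff₀ hlam0] at h3
  rw [div_mul_eq_mul_div, div_le_iff₀ (by positivity)]
  linarith

/-! ### Powers of row-finite nonnegative matrices -/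

/-- A nonnegative matrix whose row `e` is supported on the finite set `supp e`. -/
structure RowFiniteMatrix (E : Type*) where
  entry : E → E → ℝ
  supp : E → Finset E
  nonneg : ∀ e f, 0 ≤ entry e f
  eq_zero : ∀ e f, f ∉ supp e → entry e f = 0

namespace RowFiniteMatrix

variable {E : Type*} (A : RowFiniteMatrix E)

open Classical in
/-- The entries of the `n`-th power. -/
noncomputable def pow : ℕ → E → E → ℝ
  | 0, e, f => if e = f then 1 else 0
  | n + 1, e, f => ∑ g ∈ A.supp e, A.entry e g * pow n g f

def Irreducible : Prop := ∀ e f, Relation.ReflTransGen (fun a b => 0 < A.entry a b) e f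

theorem entry_mul_le_sum {v : E → ℝ} (hv : ∀ g, 0 ≤ v g) (e f : E) :
    A.entry e f * v f ≤ ∑ g ∈ A.supp e, A.entry e g * v g := by
  by_cases h : f ∈ A.supp e
  · exact Finset.single_le_sum (f := fun g => A.entry e g * v g)
      (fun g _ => mul_nonneg (A.nonneg e g) (hv g)) h
  · rw [A.eq_zero e f h, zero_mul]
    exact Finset.sum_nonneg fun g _ => mul_nonneg (A.nonneg e g) (hv g)

theorem sum_eq_add_erase [DecidableEq E] (v : E → ℝ) (e f : E) :
    ∑ g ∈ A.supp e, A.entry e g * v g =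
      A.entry e f * v f + ∑ g ∈ (A.supp e).erase f, A.entry e g * v g := by
  by_cases h : f ∈ A.supp e
  · exact (Finset.add_sum_erase _ (fun g => A.entry e g * v g) h).symm
  · rw [A.eq_zero e f h, zero_mul, zero_add, Finset.erase_eq_of_notMem h]

theorem pow_nonneg (n : ℕ) (e f : E) : 0 ≤ A.pow n e f := by
  induction n generalizing e with
  | zero => unfold pow; split_ifs <;> norm_num
  | succ n ih => exact Finset.sum_nonneg fun g _ => mul_nonneg (A.nonneg e g) (ih g)

@[simp] theorem pow_zero_self (e : E) : A.pow 0 e e = 1 := by simp [pow]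

theorem pow_mul_pow_le (m n : ℕ) (e f g : E) :
    A.pow m e g * A.pow n g f ≤ A.pow (m + n) e f := by
  induction m generalizing e with
  | zero =>
    by_cases h : e = g
    · subst h; simp
    · simpa [pow, h] using A.pow_nonneg n e f
  | succ m ih =>
    rw [Nat.add_right_comm]
    simp only [pow, Finset.sum_mul]
    refine Finset.sum_le_sum fun a _ => ?_
    rw [mul_assoc]
    exact mul_le_mul_of_nonneg_left (ih a) (A.nonneg e a)

theorem pow_pow_le (m j : ℕ) (e : E) : A.pow m e e ^ j ≤ A.pow (j * m) e e := by
  induction j with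
  | zero => simp
  | succ j ih =>
    rw [pow_succ, Nat.succ_mul]
    exact (mul_le_mul_of_nonneg_right ih (A.pow_nonneg m e e)).trans (A.pow_mul_pow_le _ _ _ _ _)

theorem exists_pow_pos {e f : E} (h : Relation.ReflTransGen (fun a b => 0 < A.entry a b) e f) :
    ∃ n, 0 < A.pow n e f := by
  induction h using Relation.ReflTransGen.head_induction_on with
  | refl => exact ⟨0, by simp⟩
  | @head a b hab _ ih =>
    obtain ⟨n, hn⟩ := ih
    exact ⟨n + 1, (mul_pos hab hn).trans_le
      (A.entry_mul_le_sum (v := fun g => A.pow n g f) (fun g => A.pow_nonneg n g f) a b)⟩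

/-- The matrix multiplied by a nonnegative scalar. -/
def smul (c : ℝ) (hc : 0 ≤ c) : RowFiniteMatrix E where
  entry e f := c * A.entry e f
  supp := A.supp
  nonneg e f := mul_nonneg hc (A.nonneg e f)
  eq_zero e f h := by rw [A.eq_zero e f h, mul_zero]

theorem smul_pow (c : ℝ) (hc : 0 ≤ c) (n : ℕ) (e f : E) :
    (A.smul c hc).pow n e f = c ^ n * A.pow n e f := by
  induction n generalizing e with
  | zero => simp [pow]
  | succ n ih =>
    simp only [pow, Finset.mul_sum]
    refine Finset.sum_congr rfl fun g _ => ?_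
    rw [ih]
    simp only [smul]
    ring

open Classical in
/-- The weight of the paths from `e` that reach `o` for the first time after `k + 1` steps. -/
noncomputable def firstPassage (o : E) : ℕ → E → ℝ
  | 0, e => A.entry e o
  | k + 1, e => ∑ g ∈ (A.supp e).erase o, A.entry e g * firstPassage o k g

theorem firstPassage_nonneg (o : E) (k : ℕ) (e : E) : 0 ≤ A.firstPassage o k e := by
  induction k generalizing e with
  | zero => exact A.nonneg e o
  | succ k ih => exact Finset.sum_nonneg fun g _ => mul_nonneg (A.nonneg e g) (ih g)

/-- Decomposition by the first visit to `o` at a positive time. For `e = o` it makes the return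
weights a renewal sequence. -/
theorem pow_succ_eq_sum_firstPassage (o : E) (n : ℕ) (e : E) :
    A.pow (n + 1) e o =
      ∑ k ∈ Finset.range (n + 1), A.firstPassage o k e * A.pow (n - k) o o := by
  classical
  induction n generalizing e with
  | zero =>
    rw [pow, A.sum_eq_add_erase _ e o, Finset.sum_eq_zero]
    · simp [firstPassage]
    · intro g hg
      simp [pow, (Finset.mem_erase.1 hg).1]
  | succ n ih =>
    rw [pow, A.sum_eq_add_erase _ e o, Finset.sum_range_succ']
    simp only [Nat.add_sub_add_right, Nat.sub_zero]
    rw [add_comm]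
    congr 1
    simp only [firstPassage, Finset.sum_mul]
    rw [Finset.sum_comm]
    refine Finset.sum_congr (by congr) fun g _ => ?_
    rw [ih g, Finset.mul_sum]
    exact Finset.sum_congr rfl fun k _ => by ring

theorem sum_firstPassage_succ [DecidableEq E] (o : E) (K : ℕ) (e : E) :
    ∑ k ∈ Finset.range (K + 1), A.firstPassage o k e = A.entry e o +
      ∑ g ∈ (A.supp e).erase o, A.entry e g * ∑ k ∈ Finset.range K, A.firstPassage o k g := by
  rw [Finset.sum_range_succ', add_comm]
  simp only [firstPassage, Finset.mul_sum]
  rw [Finset.sum_comm]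
  congr!

/-- In the recurrent case there is a positive harmonic function. -/
theorem exists_harmonic (hA : A.Irreducible) {o : E} (ho : ∀ n, A.pow n o o ≤ 1)
    (hs : ¬ Summable fun n => A.pow n o o) :
    (∃ h : E → ℝ, (∀ e, 0 < h e) ∧ ∀ e, ∑ g ∈ A.supp e, A.entry e g * h g = h e) ∧
      ∃ k, 0 < A.firstPassage o k o := by
  classical
  have hu : ∀ n, 0 ≤ A.pow n o o := fun n => A.pow_nonneg n o o
  have hphi : ∀ k e, 0 ≤ A.firstPassage o k e := A.firstPassage_nonneg o
  have hrec := fun n => A.pow_succ_eq_sum_firstPassage o n o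
  have hF := renewal_partial_sum_le_one (f := fun k => A.firstPassage o k o)
    (A.pow_zero_self o) hu ho (fun k => hphi k o) hrec
  have hHsub : ∀ K e, ∑ k ∈ Finset.range K, A.firstPassage o k o ≤ 1 →
      ∑ g ∈ A.supp e, A.entry e g * ∑ k ∈ Finset.range K, A.firstPassage o k g ≤
      ∑ k ∈ Finset.range (K + 1), A.firstPassage o k e := by
    intro K e hK
    rw [A.sum_eq_add_erase _ e o, A.sum_firstPassage_succ]
    exact add_le_add_left (mul_le_of_le_one_right (A.nonneg e o) hK) _
  -- The bound at `o` spreads along paths starting at `o`: by `hHsub`, a bound at `b` gives one at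
  -- `c` at the cost of dividing by the entry from `b` to `c`.
  have hbdd : ∀ e, ∃ C, ∀ K, ∑ k ∈ Finset.range K, A.firstPassage o k e ≤ C := by
    intro e
    induction hA o e with
    | refl => exact ⟨1, hF⟩
    | @tail b c _ hbc ih =>
      obtain ⟨C, hC⟩ := ih
      refine ⟨C / A.entry b c, fun K => ?_⟩
      rw [le_div_iff₀ hbc, mul_comm]
      refine (A.entry_mul_le_sum
        (v := fun g => ∑ k ∈ Finset.range K, A.firstPassage o k g) (fun g => ?_) b c).trans
        ((hHsub K b (hF K)).trans (hC _))
      exact Finset.sum_nonneg fun k _ => hphi k g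
  have hsum : ∀ e, Summable fun k => A.firstPassage o k e := fun e =>
    let ⟨_, hC⟩ := hbdd e
    summable_of_sum_range_le (fun k => hphi k e) hC
  let h : E → ℝ := fun e => ∑' k, A.firstPassage o k e
  have hh0 : ∀ e, 0 ≤ h e := fun e => tsum_nonneg fun k => hphi k e
  have hlim : ∀ e, Tendsto (fun K => ∑ k ∈ Finset.range K, A.firstPassage o k e) atTop (𝓝 (h e)) :=
    fun e => (hsum e).hasSum.tendsto_sum_nat
  have heq : ∀ e, h e = A.entry e o + ∑ g ∈ (A.supp e).erase o, A.entry e g * h g := by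
    intro e
    have h1 := (hlim e).comp (tendsto_add_atTop_nat 1)
    have h2 : Tendsto (fun K => A.entry e o + ∑ g ∈ (A.supp e).erase o,
        A.entry e g * ∑ k ∈ Finset.range K, A.firstPassage o k g) atTop
        (𝓝 (A.entry e o + ∑ g ∈ (A.supp e).erase o, A.entry e g * h g)) :=
      (tendsto_finsetSum _ fun g _ => (hlim g).const_mul _).const_add _
    refine tendsto_nhds_unique (h1.congr fun K => ?_) h2
    exact A.sum_firstPassage_succ o K e
  -- This is recurrence: if the total return weight `h o` were below 1, the renewal equation would
  -- bound the sum of the return weights by `1 / (1 - h o)`.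
  have hho : h o = 1 := by
    refine le_antisymm (le_of_tendsto' (hlim o) hF) ?_
    by_contra hlt
    push Not at hlt
    refine hs (summable_of_sum_range_le hu (c := 1 / (1 - h o)) fun N => ?_)
    rw [le_div_iff₀ (by linarith)]
    have h1 : ∑ n ∈ Finset.range (N + 1), A.pow n o o ≤
        h o * ∑ n ∈ Finset.range N, A.pow n o o + 1 := by
      rw [Finset.sum_range_succ', A.pow_zero_self]
      refine add_le_add_left ?_ _
      simp_rw [hrec]
      rw [Finset.sum_range_diag_flip N fun k m => A.firstPassage o k o * A.pow m o o]
      calc _ ≤ ∑ k ∈ Finset.range N, ∑ m ∈ Finset.range N,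
            A.firstPassage o k o * A.pow m o o :=
            Finset.sum_le_sum fun j _ => Finset.sum_le_sum_of_subset_of_nonneg
              (Finset.range_mono (Nat.sub_le _ _)) fun m _ _ => mul_nonneg (hphi j o) (hu m)
        _ = (∑ k ∈ Finset.range N, A.firstPassage o k o) * ∑ m ∈ Finset.range N, A.pow m o o :=
            (Finset.sum_mul_sum _ _ _ _).symm
        _ ≤ _ := mul_le_mul_of_nonneg_right ((hsum o).sum_le_tsum _ fun k _ => hphi k o)
            (Finset.sum_nonneg fun n _ => hu n)
    have h2 : ∑ n ∈ Finset.range N, A.pow n o o ≤ ∑ n ∈ Finset.range (N + 1), A.pow n o o :=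
      Finset.sum_le_sum_of_subset_of_nonneg (Finset.range_mono (Nat.le_succ N)) fun n _ _ => hu n
    linarith
  have hharm : ∀ e, ∑ g ∈ A.supp e, A.entry e g * h g = h e := by
    intro e
    rw [A.sum_eq_add_erase h e o, heq e, hho, mul_one]
  refine ⟨⟨h, fun e => ?_, hharm⟩, ?_⟩
  · induction hA e o using Relation.ReflTransGen.head_induction_on with
    | refl => rw [hho]; exact one_pos
    | @head a b hab _ ih =>
      rw [← hharm a]
      exact (mul_pos hab ih).trans_le (A.entry_mul_le_sum hh0 a b)
  · by_contra hno
    push Not at hno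
    have : h o = 0 := by
      have h0 : ∀ k, A.firstPassage o k o = 0 := fun k => le_antisymm (hno k) (hphi k o)
      simp [h, h0]
    linarith

/-- A matrix with a positive harmonic function cannot have infinitely many diagonal entries
whose return sequences have a common positive lower density. -/
theorem finite_of_density (hA : A.Irreducible) {h : E → ℝ} (hpos : ∀ e, 0 < h e)
    (hharm : ∀ e, ∑ g ∈ A.supp e, A.entry e g * h g = h e) {δ : ℝ} (hδ : 0 < δ) {T : Set E}
    (hT : ∀ f ∈ T, ∀ N : ℕ, δ * N ≤ ∑ n ∈ Finset.range N, A.pow n f f) : T.Finite := by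
  classical
  -- Conjugation by `h` makes the matrix stochastic; this is conservation of mass, for finite sets
  -- of targets.
  have hmass : ∀ (n : ℕ) (e : E) (F : Finset E), ∑ f ∈ F, A.pow n e f * h f ≤ h e := by
    intro n
    induction n with
    | zero =>
      intro e F
      simp only [pow, ite_mul, one_mul, zero_mul, Finset.sum_ite_eq]
      split_ifs
      exacts [le_rfl, (hpos e).le]
    | succ n ih =>
      intro e F
      simp only [pow, Finset.sum_mul]
      rw [Finset.sum_comm]
      conv_rhs => rw [← hharm e]
      refine Finset.sum_le_sum fun g _ => ?_
      simp_rw [mul_assoc, ← Finset.mul_sum]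
      exact mul_le_mul_of_nonneg_left (ih g F) (A.nonneg e g)
  have hpow : ∀ n e f, A.pow n e f ≤ h e / h f := by
    intro n e f
    rw [le_div_iff₀ (hpos f)]
    simpa using hmass n e {f}
  let S : ℕ → E → E → ℝ := fun N e f => ∑ n ∈ Finset.range N, A.pow n e f
  have hSsucc : ∀ N e f, S (N + 1) e f = A.pow 0 e f + ∑ g ∈ A.supp e, A.entry e g * S N g f := by
    intro N e f
    simp only [S]
    rw [Finset.sum_range_succ', add_comm]
    simp only [pow, Finset.mul_sum]
    rw [Finset.sum_comm]
  have hS0 : ∀ N e f, 0 ≤ S N e f := fun N e f => Finset.sum_nonneg fun n _ => A.pow_nonneg n e f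
  -- For the conjugated chain: the expected number of visits to `f` before time `N` is largest when
  -- the chain starts at `f`.
  have hmax : ∀ N e f, S N e f ≤ h e / h f * S N f f := by
    intro N
    induction N with
    | zero => intro e f; simp [S]
    | succ N ih =>
      intro e f
      by_cases hef : e = f
      · subst hef
        rw [div_self (hpos e).ne', one_mul]
      · have hle : S N f f ≤ S (N + 1) f f :=
          Finset.sum_le_sum_of_subset_of_nonneg (Finset.range_mono (Nat.le_succ N))
            fun n _ _ => A.pow_nonneg n f f
        calc S (N + 1) e f = ∑ g ∈ A.supp e, A.entry e g * S N g f := by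
              rw [hSsucc]; simp [pow, hef]
          _ ≤ ∑ g ∈ A.supp e, A.entry e g * (h g / h f * S N f f) :=
              Finset.sum_le_sum fun g _ => mul_le_mul_of_nonneg_left (ih g f) (A.nonneg e g)
          _ = (∑ g ∈ A.supp e, A.entry e g * h g) * (S N f f / h f) := by
              rw [Finset.sum_mul]
              exact Finset.sum_congr rfl fun g _ => by ring
          _ = h e / h f * S N f f := by rw [hharm]; ring
          _ ≤ _ := mul_le_mul_of_nonneg_left hle (div_pos (hpos e) (hpos f)).le
  let U := hyperfilter ℕ
  have hU : (U : Filter ℕ) ≤ atTop := by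
    rw [← Nat.cofinite_eq_atTop]; exact hyperfilter_le_cofinite
  have hex : ∀ e f, ∃ w, Tendsto (fun N : ℕ => S N e f / N) U (𝓝 w) := by
    intro e f
    obtain ⟨w, _, hw⟩ := exists_ultrafilter_limit U (v := fun N : ℕ => S N e f / N)
      (C := h e / h f) (fun N => div_nonneg (hS0 N e f) (Nat.cast_nonneg N)) fun N => by
        refine div_le_of_le_mul₀ (Nat.cast_nonneg N) (div_pos (hpos e) (hpos f)).le ?_
        calc S N e f ≤ ∑ n ∈ Finset.range N, h e / h f := Finset.sum_le_sum fun n _ => hpow n e f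
          _ = _ := by simp [mul_comm]
    exact ⟨w, hw⟩
  choose c hc using hex
  -- Applying the matrix shifts the time window by one, which changes `S N e f` only by bounded
  -- boundary terms; these vanish after division by `N`.
  have hcharm : ∀ e f, ∑ g ∈ A.supp e, A.entry e g * c g f = c e f := by
    intro e f
    have h1 : Tendsto (fun N : ℕ => ∑ g ∈ A.supp e, A.entry e g * (S N g f / N)) U
        (𝓝 (∑ g ∈ A.supp e, A.entry e g * c g f)) :=
      tendsto_finsetSum _ fun g _ => (hc g f).const_mul _
    have h2 : Tendsto (fun N : ℕ => (h e / h f + 1) / (N : ℝ)) U (𝓝 0) :=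
      (tendsto_const_div_atTop_nhds_zero_nat _).mono_left hU
    have h3 : Tendsto (fun N : ℕ => S N e f / N -
        ∑ g ∈ A.supp e, A.entry e g * (S N g f / N)) U (𝓝 0) := by
      refine squeeze_zero_norm (fun N => ?_) h2
      have e1 : ∑ g ∈ A.supp e, A.entry e g * (S N g f / N) =
          (S (N + 1) e f - A.pow 0 e f) / N := by
        rw [hSsucc, add_sub_cancel_left, Finset.sum_div]
        exact Finset.sum_congr rfl fun g _ => by ring
      have e2 : S (N + 1) e f = S N e f + A.pow N e f := Finset.sum_range_succ _ _
      rw [e1, ← sub_div, norm_div, Real.norm_natCast]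
      refine div_le_div_of_nonneg_right ?_ (Nat.cast_nonneg N)
      have p0 := A.pow_nonneg 0 e f
      have p1 := A.pow_nonneg N e f
      have p2 : A.pow 0 e f ≤ 1 := by unfold pow; split_ifs <;> norm_num
      have p3 := hpow N e f
      rw [e2, Real.norm_eq_abs, abs_le]
      constructor <;> linarith
    have h4 := tendsto_nhds_unique h3 ((hc e f).sub h1)
    linarith
  have hcle : ∀ e f, c e f ≤ h e / h f * c f f := fun e f =>
    le_of_tendsto_of_tendsto' (hc e f) ((hc f f).const_mul _) fun N => by
      rw [← mul_div_assoc]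
      exact div_le_div_of_nonneg_right (hmax N e f) (Nat.cast_nonneg N)
  -- Maximum principle: the difference of the two sides is harmonic in `e`, of one sign, and zero at
  -- `e = f`, so it vanishes along every path from `f`.
  have hceq : ∀ e f, c e f = h e / h f * c f f := by
    intro e f
    induction hA f e with
    | refl => rw [div_self (hpos f).ne', one_mul]
    | @tail a b _ hab ih =>
      have hdiff : ∑ g ∈ A.supp a, A.entry a g * (h g / h f * c f f - c g f) = 0 := by
        simp_rw [mul_sub, Finset.sum_sub_distrib]
        rw [hcharm, ih, sub_eq_zero]
        calc _ = (∑ g ∈ A.supp a, A.entry a g * h g) * (c f f / h f) := by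
              rw [Finset.sum_mul]
              exact Finset.sum_congr rfl fun g _ => by ring
          _ = _ := by rw [hharm]; ring
      have h1 := A.entry_mul_le_sum (v := fun g => h g / h f * c f f - c g f)
        (fun g => sub_nonneg.2 (hcle g f)) a b
      rw [hdiff] at h1
      have h2 : h b / h f * c f f - c b f ≤ 0 := by
        by_contra hlt
        push Not at hlt
        exact absurd h1 (not_le.2 (mul_pos hab hlt))
      exact le_antisymm (hcle b f) (by linarith)
  have hcT : ∀ f ∈ T, δ ≤ c f f := fun f hf =>
    ge_of_tendsto (hc f f) (hU ((eventually_gt_atTop 0).mono fun N hN => by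
      rw [le_div_iff₀ (Nat.cast_pos.2 hN)]
      exact hT f hf N))
  rcases T.eq_empty_or_nonempty with rfl | ⟨o, _⟩
  · exact Set.finite_empty
  have hcmass : ∀ F : Finset E, ∑ f ∈ F, c o f * h f ≤ h o := by
    intro F
    have h1 : Tendsto (fun N : ℕ => ∑ f ∈ F, S N o f / N * h f) U (𝓝 (∑ f ∈ F, c o f * h f)) :=
      tendsto_finsetSum _ fun f _ => (hc o f).mul_const _
    refine le_of_tendsto' h1 fun N => ?_
    calc ∑ f ∈ F, S N o f / N * h f = (∑ n ∈ Finset.range N, ∑ f ∈ F, A.pow n o f * h f) / N := by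
          rw [Finset.sum_comm, Finset.sum_div]
          refine Finset.sum_congr rfl fun f _ => ?_
          simp only [S, ← Finset.sum_mul]
          ring
      _ ≤ (∑ n ∈ Finset.range N, h o) / N :=
          div_le_div_of_nonneg_right (Finset.sum_le_sum fun n _ => hmass n o F) (Nat.cast_nonneg N)
      _ ≤ h o := by
          refine div_le_of_le_mul₀ (Nat.cast_nonneg N) (hpos o).le ?_
          simp [mul_comm]
  by_contra hinf
  obtain ⟨k, hk⟩ := exists_nat_gt (1 / δ)
  obtain ⟨F, hFT, hFk⟩ := Set.Infinite.exists_subset_card_eq hinf k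
  -- By `hceq`, each `f ∈ T` takes at least the share `δ` of the mass `h o`, so `T` has at most `1 /
  -- δ` elements.
  have h1 : (k * δ) * h o ≤ h o := by
    calc (k * δ) * h o = ∑ f ∈ F, δ * h o := by simp [hFk, mul_assoc]
      _ ≤ ∑ f ∈ F, c o f * h f := Finset.sum_le_sum fun f hf => by
          rw [hceq o f]
          have := (hpos f).ne'
          calc δ * h o ≤ c f f * h o := mul_le_mul_of_nonneg_right (hcT f (hFT hf)) (hpos o).le
            _ = _ := by field_simp
      _ ≤ h o := hcmass F
  rw [div_lt_iff₀ hδ] at hk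
  have := hpos o
  nlinarith

theorem pow_diag_tendsto_zero (hA : A.Irreducible) {o : E} (ho : ∀ n, A.pow n o o ≤ 1)
    (hinf : {f | ∀ n, A.pow n f f = A.pow n o o}.Infinite) :
    Tendsto (fun n => A.pow n o o) atTop (𝓝 0) := by
  by_cases hs : Summable fun n => A.pow n o o
  · exact hs.tendsto_atTop_zero
  obtain ⟨⟨h, hpos, hharm⟩, k, hk⟩ := A.exists_harmonic hA ho hs
  by_contra hlim
  obtain ⟨δ, hδ, hd⟩ := renewal_density (f := fun k => A.firstPassage o k o) (A.pow_zero_self o)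
    (fun n => A.pow_nonneg n o o) ho (fun k => A.firstPassage_nonneg o k o)
    (fun n => A.pow_succ_eq_sum_firstPassage o n o) hk hlim
  refine hinf (A.finite_of_density hA hpos hharm hδ fun f hf N => ?_)
  simpa only [show ∀ n, A.pow n f f = A.pow n o o from hf] using hd N

/-- A path from `e` to `f` extends by fixed paths from `o` to `e` and from `f` to `o` to a closed
path at `o`, so the diagonal case suffices. -/
theorem pow_tendsto_zero (hA : A.Irreducible) {o : E} (ho : ∀ n, A.pow n o o ≤ 1)
    (hinf : {f | ∀ n, A.pow n f f = A.pow n o o}.Infinite) (e f : E) :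
    Tendsto (fun n => A.pow n e f) atTop (𝓝 0) := by
  obtain ⟨i, hi⟩ := A.exists_pow_pos (hA o e)
  obtain ⟨j, hj⟩ := A.exists_pow_pos (hA f o)
  have h1 : Tendsto (fun n => A.pow (i + n + j) o o / (A.pow i o e * A.pow j f o)) atTop (𝓝 0) := by
    have := ((A.pow_diag_tendsto_zero hA ho hinf).comp (tendsto_add_atTop_nat (i + j))).div_const
      (A.pow i o e * A.pow j f o)
    rw [zero_div] at this
    refine this.congr fun n => ?_
    simp only [Function.comp]
    congr 2
    ring
  refine squeeze_zero (fun n => A.pow_nonneg n e f) (fun n => ?_) h1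
  rw [le_div_iff₀ (mul_pos hi hj)]
  calc A.pow n e f * (A.pow i o e * A.pow j f o) = A.pow i o e * A.pow n e f * A.pow j f o := by ring
    _ ≤ A.pow (i + n) o f * A.pow j f o :=
        mul_le_mul_of_nonneg_right (A.pow_mul_pow_le _ _ _ _ _) hj.le
    _ ≤ _ := A.pow_mul_pow_le _ _ _ _ _

end RowFiniteMatrix

namespace RowFiniteMatrix

variable {E : Type*} (A : RowFiniteMatrix E)

/-- An irreducible matrix with infinitely many equivalent diagonal entries is `ρ`-null. -/
theorem exists_spectral_radius (hA : A.Irreducible) {o o' : E} (hne : o ≠ o')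
    (ho : ∀ n, A.pow n o o ≤ 1) (hinf : {f | ∀ n, A.pow n f f = A.pow n o o}.Infinite) :
    ∃ ρ > 0, (∀ e f, Tendsto (fun n => A.pow n e f / ρ ^ n) atTop (𝓝 0)) ∧
      ∀ r < ρ, ∃ m > 0, 0 < A.pow m o o ∧ r < A.pow m o o ^ (1 / (m : ℝ)) := by
  -- The radius is the supremum of `S`, so division by its powers keeps the return weights at most
  -- 1. The second state `o'` serves to find a return of positive length, so that `S` is nonempty.
  let S : Set ℝ := {t | ∃ m > 0, 0 < A.pow m o o ∧ t = A.pow m o o ^ (1 / (m : ℝ))}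
  have hSb : BddAbove S := by
    refine ⟨1, ?_⟩
    rintro _ ⟨m, _, hm, rfl⟩
    exact Real.rpow_le_one hm.le (ho m) (by positivity)
  obtain ⟨t, ht⟩ : S.Nonempty := by
    obtain ⟨i, hi⟩ := A.exists_pow_pos (hA o o')
    obtain ⟨j, hj⟩ := A.exists_pow_pos (hA o' o)
    refine ⟨_, i + j, Nat.add_pos_left (Nat.pos_of_ne_zero ?_) j,
      (mul_pos hi hj).trans_le (A.pow_mul_pow_le _ _ _ _ _), rfl⟩
    rintro rfl
    simp [pow, hne] at hi
  have htpos : 0 < t := by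
    obtain ⟨m, _, hm, rfl⟩ := ht
    exact Real.rpow_pos_of_pos hm _
  have hρ : 0 < sSup S := htpos.trans_le (le_csSup hSb ht)
  refine ⟨sSup S, hρ, fun e f => ?_, fun r hr => ?_⟩
  · have hc : 0 ≤ (sSup S)⁻¹ := (inv_pos.2 hρ).le
    have hpw : ∀ n e f, (A.smul _ hc).pow n e f = A.pow n e f / sSup S ^ n := fun n e f => by
      rw [A.smul_pow, inv_pow, div_eq_inv_mul]
    simp_rw [← hpw]
    refine pow_tendsto_zero _ (o := o) (fun a b => ?_) (fun n => ?_) ?_ e f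
    · exact (hA a b).lift id fun x y hxy => mul_pos (inv_pos.2 hρ) hxy
    · rw [hpw, div_le_one (pow_pos hρ n)]
      rcases Nat.eq_zero_or_pos n with rfl | hn
      · simp
      rcases (A.pow_nonneg n o o).eq_or_lt with h0 | h0
      · rw [← h0]; positivity
      · have h1 : A.pow n o o ^ (1 / (n : ℝ)) ≤ sSup S := le_csSup hSb ⟨n, hn, h0, rfl⟩
        calc A.pow n o o = (A.pow n o o ^ (1 / (n : ℝ))) ^ n := by
              rw [← Real.rpow_natCast, ← Real.rpow_mul h0.le, one_div,
                inv_mul_cancel₀ (Nat.cast_ne_zero.2 hn.ne'), Real.rpow_one]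
          _ ≤ _ := pow_le_pow_left₀ (by positivity) h1 n
    · refine hinf.mono fun f hf n => ?_
      rw [hpw, hpw, hf n]
  · obtain ⟨_, ⟨m, hm, hm', rfl⟩, h⟩ := exists_lt_of_lt_csSup ⟨t, ht⟩ hr
    exact ⟨m, hm, hm', h⟩

end RowFiniteMatrix

/-- The exponential rate of a sequence that is `o(ρⁿ)` and dominates the powers of
numbers close to `ρ` along arithmetic progressions. -/
theorem limsup_rpow_one_div_eq {v : ℕ → ℝ} {ρ : ℝ} (hρ : 0 < ρ) (h0 : ∀ n, 0 ≤ v n)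
    (hup : Tendsto (fun n => v n / ρ ^ n) atTop (𝓝 0))
    (hlow : ∀ r < ρ, ∃ c > 0, ∃ k m : ℕ, ∃ a > 0, 0 < m ∧ r < a ^ (1 / (m : ℝ)) ∧
      ∀ j : ℕ, c * a ^ j ≤ v (j * m + k)) :
    limsup (fun n : ℕ => v n ^ (1 / (n : ℝ))) atTop = ρ := by
  have hle : ∀ᶠ n : ℕ in atTop, v n ^ (1 / (n : ℝ)) ≤ ρ := by
    filter_upwards [hup.eventually (gt_mem_nhds one_pos), eventually_gt_atTop 0] with n hn hpos
    rw [div_lt_one (pow_pos hρ n)] at hn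
    calc v n ^ (1 / (n : ℝ)) ≤ (ρ ^ n) ^ (1 / (n : ℝ)) :=
          Real.rpow_le_rpow (h0 n) hn.le (by positivity)
      _ = ρ := by rw [one_div, Real.pow_rpow_inv_natCast hρ.le hpos.ne']
  have hb : IsBoundedUnder (· ≤ ·) atTop fun n : ℕ => v n ^ (1 / (n : ℝ)) := ⟨ρ, hle⟩
  have hc : IsCoboundedUnder (· ≤ ·) atTop fun n : ℕ => v n ^ (1 / (n : ℝ)) :=
    (isBoundedUnder_of ⟨0, fun n => Real.rpow_nonneg (h0 n) _⟩ :
      IsBoundedUnder (· ≥ ·) atTop _).isCoboundedUnder_le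
  refine le_antisymm (limsup_le_of_le hc hle) (le_of_forall_lt fun r hr => ?_)
  obtain ⟨r', hrr', hr'⟩ := exists_between hr
  refine hrr'.trans_le ?_
  obtain ⟨c, hcpos, k, m, a, ha, hm, hra, hj⟩ := hlow r' hr'
  have hnt : Tendsto (fun j : ℕ => j * m + k) atTop atTop :=
    tendsto_atTop_mono (fun j => (Nat.le_mul_of_pos_right j hm).trans (Nat.le_add_right _ _))
      tendsto_id
  have hmr : (0 : ℝ) < m := Nat.cast_pos.2 hm
  have hinv : Tendsto (fun j : ℕ => 1 / ((j * m + k : ℕ) : ℝ)) atTop (𝓝 0) :=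
    tendsto_one_div_atTop_nhds_zero_nat.comp hnt
  have hexp : Tendsto (fun j : ℕ => (j : ℝ) * (1 / ((j * m + k : ℕ) : ℝ))) atTop
      (𝓝 (1 / (m : ℝ))) := by
    have h1 : Tendsto (fun j : ℕ => (1 - k * (1 / ((j * m + k : ℕ) : ℝ))) * (1 / (m : ℝ))) atTop
        (𝓝 ((1 - k * 0) * (1 / (m : ℝ)))) :=
      ((hinv.const_mul (k : ℝ)).const_sub 1).mul_const _
    rw [mul_zero, sub_zero, one_mul] at h1
    refine h1.congr' ((eventually_gt_atTop 0).mono fun j hj => ?_)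
    have : ((j * m + k : ℕ) : ℝ) ≠ 0 := by positivity
    field_simp
    push_cast
    ring
  -- Along the times `j * m + k`, the constant `c` and the offset `k` disappear under the root.
  have hlim : Tendsto (fun j : ℕ => c ^ (1 / ((j * m + k : ℕ) : ℝ)) *
      a ^ ((j : ℝ) * (1 / ((j * m + k : ℕ) : ℝ)))) atTop (𝓝 (c ^ (0 : ℝ) * a ^ (1 / (m : ℝ)))) :=
    (tendsto_const_nhds.rpow hinv (Or.inl hcpos.ne')).mul (tendsto_const_nhds.rpow hexp (Or.inl ha.ne'))
  rw [Real.rpow_zero, one_mul] at hlim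
  have hev := hlim.eventually (lt_mem_nhds hra)
  refine le_limsup_of_frequently_le (hnt.frequently (p := fun n => r' ≤ v n ^ (1 / (n : ℝ)))
    (hev.mono fun j hjr => ?_).frequently) hb
  refine hjr.le.trans ?_
  rw [Real.rpow_mul ha.le, Real.rpow_natCast, ← Real.mul_rpow hcpos.le (by positivity)]
  exact Real.rpow_le_rpow (by positivity) (hj j) (by positivity)

/-! ### Reachability by non-backtracking paths -/

namespace LFGraph

variable {V E : Type*} (G : LFGraph V E)

theorem src_rev (e : E) : G.src (G.rev e) = G.tgt e := rfl

theorem tgt_rev (e : E) : G.tgt (G.rev e) = G.src e := by rw [tgt, G.rev_rev]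

theorem rev_injective : Function.Injective G.rev := Function.LeftInverse.injective G.rev_rev

theorem Adj.symm {x y : V} (h : G.Adj x y) : G.Adj y x := by
  obtain ⟨e, rfl, rfl⟩ := h
  exact ⟨G.rev e, rfl, G.tgt_rev e⟩

theorem Follows.rev {e f : E} (h : G.Follows e f) : G.Follows (G.rev f) (G.rev e) := by
  refine ⟨?_, fun hc => h.2 ?_⟩
  · rw [tgt_rev, src_rev, h.1]
  · rw [hc, G.rev_rev]

/-- `f` is reached from `e` by a non-backtracking path. -/
def Reach (e f : E) : Prop := Relation.ReflTransGen G.Follows e f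

variable {G}

theorem Reach.rev {e f : E} (h : G.Reach e f) : G.Reach (G.rev f) (G.rev e) := by
  induction h with
  | refl => exact .refl
  | tail _ hbc ih => exact .head (Follows.rev G hbc) ih

/-- `Near G n x y`: the distance between `x` and `y` is at most `n`. -/
inductive Near (G : LFGraph V E) : ℕ → V → V → Prop
  | refl (n x) : Near G n x x
  | head {n x y z} : G.Adj x y → Near G n y z → Near G (n + 1) x z

theorem Near.mono {m n : ℕ} {x y : V} (h : G.Near m x y) (hmn : m ≤ n) : G.Near n x y := by
  induction h generalizing n with
  | refl => exact .refl _ _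
  | head ha _ ih =>
    obtain ⟨k, rfl⟩ : ∃ k, n = k + 1 := ⟨n - 1, by omega⟩
    exact .head ha (ih (by omega))

theorem Near.trans {m n : ℕ} {x y z : V} (h : G.Near m x y) (h' : G.Near n y z) :
    G.Near (m + n) x z := by
  induction h with
  | refl => exact h'.mono (Nat.le_add_left _ _)
  | head ha _ ih => rw [Nat.add_right_comm]; exact .head ha (ih h')

theorem Near.symm {n : ℕ} {x y : V} (h : G.Near n x y) : G.Near n y x := by
  induction h with
  | refl => exact .refl _ _
  | head ha _ ih => exact ih.trans (.head (Adj.symm G ha) (.refl 0 _))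

theorem finite_near (n : ℕ) (y : V) : {x | G.Near n x y}.Finite := by
  induction n with
  | zero =>
    refine (Set.finite_singleton y).subset fun x hx => ?_
    cases hx
    rfl
  | succ n ih =>
    have h : ({y} ∪ ⋃ z ∈ {x | G.Near n x y}, G.src '' {e | G.tgt e = z}).Finite :=
      (Set.finite_singleton y).union (ih.biUnion fun z _ => (G.finite_tgt z).image _)
    refine h.subset fun x hx => ?_
    rcases hx with _ | ⟨⟨e, rfl, rfl⟩, hz⟩
    · exact Or.inl rfl
    · exact Or.inr (Set.mem_biUnion (show _ ∈ {x | G.Near n x y} from hz) ⟨e, rfl, rfl⟩)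

theorem exists_near (hconn : G.Connected) (x y : V) : ∃ n, G.Near n x y := by
  induction hconn.2 x y using Relation.ReflTransGen.head_induction_on with
  | refl => exact ⟨0, .refl _ _⟩
  | head h _ ih =>
    obtain ⟨n, hn⟩ := ih
    exact ⟨n + 1, .head h hn⟩

theorem exists_follows (hdeg : ∀ x, 2 ≤ G.deg x) (e : E) : ∃ f, G.Follows e f := by
  obtain ⟨f, hf, hne⟩ := Finset.exists_mem_ne (hdeg (G.tgt e)) (G.rev e)
  exact ⟨f, by simpa [outEdges] using hf, hne⟩

/-- If the reversal of `e` is not reachable, then an edge reachable from `e` is determined by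
its terminal vertex. -/
theorem Reach.eq_of_tgt_eq {e f f' : E} (he : ¬ G.Reach e (G.rev e)) (hf : G.Reach e f)
    (hf' : G.Reach e f') (h : G.tgt f = G.tgt f') : f = f' := by
  by_contra hne
  -- Two distinct edges with the same end allow a turn: go out along `f'` and return along the
  -- reversal of the path to `f`.
  have h1 : G.Follows f' (G.rev f) := ⟨by rw [src_rev, h], fun hc => hne (G.rev_injective hc)⟩
  exact he ((hf'.tail h1).trans hf.rev)

/-- If the reversal of `e` is not reachable, then every non-backtracking closed path of edges
reachable from `e` contains `e`. -/
theorem Reach.mem_closed {e : E} (he : ¬ G.Reach e (G.rev e)) {n : ℕ} (hn : 0 < n) {c : ℕ → E}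
    (hper : c n = c 0) (hc : ∀ k < n, G.Follows (c k) (c (k + 1))) (h0 : G.Reach e (c 0)) :
    ∃ k < n, c k = e := by
  have hR : ∀ k ≤ n, G.Reach e (c k) := by
    intro k
    induction k with
    | zero => exact fun _ => h0
    | succ k ih => exact fun hk => (ih (by omega)).tail (hc k hk)
  -- Reachable predecessors are unique, so tracing the path from `e` to `f` backwards never leaves
  -- the closed path.
  have key : ∀ f, G.Reach e f → (∃ k < n, c k = f) → ∃ k < n, c k = e := by
    intro f hf
    induction hf with
    | refl => exact id
    | @tail b f hb hbf ih =>
      rintro ⟨k, hk, rfl⟩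
      refine ih ?_
      obtain ⟨j, hj, hjk⟩ : ∃ j < n, c (j + 1) = c k := by
        rcases Nat.eq_zero_or_pos k with rfl | hpos
        · exact ⟨n - 1, by omega, by rw [Nat.sub_add_cancel hn, hper]⟩
        · exact ⟨k - 1, by omega, by rw [Nat.sub_add_cancel hpos]⟩
      refine ⟨j, hj, Reach.eq_of_tgt_eq he (hR j hj.le) hb ?_⟩
      rw [← (hc j hj).1, hjk, hbf.1]
  exact key _ h0 ⟨0, hn, rfl⟩

/-- If `e` could not be reversed, the part of the graph beyond `e` could be left only through `e`,
and every cycle met there would pass through the end of `e`. Cycles occur near every vertex, so this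
part is bounded. A finite set of reachable edges leads back to `e` itself, so it covers the whole
vertex set, which is infinite. -/
theorem reach_rev (hinf : Infinite V) (hconn : G.Connected) (hdeg : ∀ x, 2 ≤ G.deg x)
    {D n : ℕ} (hcyc : ∀ x, ∃ c : ℕ → E, G.IsCycle n c ∧ G.Near D x (G.src (c 0))) (e : E) :
    G.Reach e (G.rev e) := by
  by_contra he
  have hdich : ∀ f, G.Reach e f → ∀ a, G.src a = G.tgt f → a = G.rev f ∨ G.Reach e a := by
    intro f hf a ha
    by_cases h : a = G.rev f
    · exact Or.inl h
    · exact Or.inr (hf.tail ⟨ha, h⟩)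
  have hpred : ∀ f, G.Reach e f → f = e ∨ ∃ b, G.Reach e b ∧ G.Follows b f := by
    intro f hf
    rcases Relation.ReflTransGen.cases_tail hf with h | ⟨b, hb, hbf⟩
    · exact Or.inl h
    · exact Or.inr ⟨b, hb, hbf⟩
  -- A path can leave the set of ends of reachable edges only by traversing `e` backwards, hence
  -- only from `G.tgt e`.
  have hstay : ∀ k v w, G.Near k v w → (∃ f, G.Reach e f ∧ G.tgt f = v) →
      (∃ f, G.Reach e f ∧ G.tgt f = w) ∨ G.Near k v (G.tgt e) := by
    intro k v w h
    induction h with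
    | refl => exact fun h => Or.inl h
    | head ha _ ih =>
      rintro ⟨f, hf, rfl⟩
      obtain ⟨a, ha1, rfl⟩ := id ha
      have hz : (∃ f, G.Reach e f ∧ G.tgt f = G.tgt a) ∨ f = e := by
        rcases hdich f hf a ha1 with rfl | hRa
        · rcases hpred f hf with rfl | ⟨b, hb, hbf⟩
          · exact Or.inr rfl
          · exact Or.inl ⟨b, hb, by rw [tgt_rev, hbf.1]⟩
        · exact Or.inl ⟨a, hRa, rfl⟩
      rcases hz with hz | rfl
      · exact (ih hz).imp_right fun h => .head ha h
      · exact Or.inr (.refl _ _)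
  have hnear : ∀ f, G.Reach e f → G.Near (D + n) (G.tgt f) (G.tgt e) := by
    intro f hf
    obtain ⟨c, ⟨hn, hper, -, hc⟩, hD⟩ := hcyc (G.tgt f)
    rcases hstay D _ _ hD ⟨f, hf, rfl⟩ with ⟨f', hf', hw⟩ | h
    swap
    · exact h.mono (Nat.le_add_right _ _)
    refine hD.trans ?_
    have hsrc : ∀ k ≤ n, G.Near k (G.src (c 0)) (G.src (c k)) := by
      intro k
      induction k with
      | zero => exact fun _ => .refl _ _
      | succ k ih =>
        exact fun hk => (ih (by omega)).trans
          (.head ⟨c k, rfl, rfl⟩ (by rw [(hc k hk).1]; exact .refl 0 _))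
    rcases hdich f' hf' (c 0) hw.symm with h0 | h0
    -- If the cycle starts by backtracking along `f'`, the reversed cycle starts with `f'` and
    -- consists of reachable edges.
    · obtain ⟨k, hk, hke⟩ := Reach.mem_closed he hn (c := fun k => G.rev (c (n - k)))
        (by simp [hper]) (fun k hk => by
          have := Follows.rev G (hc (n - (k + 1)) (by omega))
          rwa [show n - (k + 1) + 1 = n - k by omega] at this)
        (by simpa [hper, h0, G.rev_rev] using hf')
      have : G.tgt e = G.src (c (n - k)) := by rw [← hke, tgt_rev]
      rw [this]
      exact (hsrc (n - k) (Nat.sub_le _ _)).mono (Nat.sub_le _ _)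
    · obtain ⟨k, hk, hke⟩ := Reach.mem_closed he hn hper hc h0
      have : G.tgt e = G.src (c (k + 1)) := by rw [← hke, (hc k hk).1]
      rw [this]
      exact (hsrc (k + 1) hk).mono hk
  have hRfin : {f | G.Reach e f}.Finite := by
    refine Set.Finite.of_finite_image ((finite_near (G := G) (D + n) (G.tgt e)).subset ?_)
      (f := G.tgt) fun f hf f' hf' h => Reach.eq_of_tgt_eq he hf hf' h
    rintro _ ⟨f, hf, rfl⟩
    exact hnear f hf
  -- A choice of successors is an injective self-map of the finite reachable set, hence surjective,
  -- so `e` has a reachable predecessor.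
  have hloop : ∃ b, G.Reach e b ∧ G.Follows b e := by
    choose s hs using fun f : E => exists_follows hdeg f
    have : Finite {f | G.Reach e f} := hRfin
    let S : {f | G.Reach e f} → {f | G.Reach e f} := fun f => ⟨s f.1, f.2.tail (hs f.1)⟩
    have hS : Function.Injective S := by
      intro f f' h
      have h1 : s f.1 = s f'.1 := congrArg Subtype.val h
      refine Subtype.ext (Reach.eq_of_tgt_eq he f.2 f'.2 ?_)
      rw [← (hs f.1).1, h1, (hs f'.1).1]
    obtain ⟨b, hb⟩ := Finite.surjective_of_injective hS ⟨e, .refl⟩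
    have h1 : s b.1 = e := congrArg Subtype.val hb
    have h2 := hs b.1
    rw [h1] at h2
    exact ⟨b.1, b.2, h2⟩
  have hclosed : ∀ w, ∃ f, G.Reach e f ∧ G.tgt f = w := by
    intro w
    induction hconn.2 (G.tgt e) w with
    | refl => exact ⟨e, .refl, rfl⟩
    | tail _ h ih =>
      obtain ⟨f, hf, rfl⟩ := ih
      obtain ⟨a, ha, rfl⟩ := h
      rcases hdich f hf a ha with rfl | hRa
      · rcases hpred f hf with rfl | ⟨b, hb, hbf⟩
        · obtain ⟨b, hb, hbf⟩ := hloop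
          exact ⟨b, hb, by rw [tgt_rev, hbf.1]⟩
        · exact ⟨b, hb, by rw [tgt_rev, hbf.1]⟩
      · exact ⟨a, hRa, rfl⟩
  refine Set.infinite_univ (α := V) ((hRfin.image G.tgt).subset fun w _ => ?_)
  obtain ⟨f, hf, rfl⟩ := hclosed w
  exact ⟨f, hf, rfl⟩

/-- Once every edge can be reversed, the non-backtracking condition is no restriction on
reachability. -/
theorem reach_of_reach_rev (hconn : G.Connected) (h : ∀ e, G.Reach e (G.rev e)) (e f : E) :
    G.Reach e f := by
  have hnext : ∀ e a, G.src a = G.tgt e → G.Reach e a := by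
    intro e a ha
    by_cases hae : a = G.rev e
    · rw [hae]; exact h e
    · exact .single ⟨ha, hae⟩
  have key : ∀ w, ∀ a, G.src a = w → G.Reach e a := by
    intro w
    induction hconn.2 (G.tgt e) w with
    | refl => exact fun a ha => hnext e a ha
    | tail _ hadj ih =>
      obtain ⟨b, hb, rfl⟩ := hadj
      exact fun a ha => (ih b hb).trans (hnext b a ha)
  exact key _ f rfl

/-! ### Automorphisms lifted to edges, and almost transitivity -/

/-- An automorphism of the edge structure over a permutation of the vertices. -/
structure EdgeLift (G : LFGraph V E) (g : Equiv.Perm V) where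
  toEquiv : E ≃ E
  src_apply : ∀ e, G.src (toEquiv e) = g (G.src e)
  rev_apply : ∀ e, G.rev (toEquiv e) = toEquiv (G.rev e)

namespace EdgeLift

variable {g : Equiv.Perm V} (φ : EdgeLift G g)

theorem tgt_apply (e : E) : G.tgt (φ.toEquiv e) = g (G.tgt e) := by
  rw [tgt, φ.rev_apply, φ.src_apply, tgt]

theorem follows_iff (e f : E) : G.Follows (φ.toEquiv e) (φ.toEquiv f) ↔ G.Follows e f := by
  simp [Follows, φ.src_apply, φ.tgt_apply, φ.rev_apply]

theorem deg_apply (φ : EdgeLift G g) (x : V) : G.deg (g x) = G.deg x := by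
  symm
  refine Finset.card_bij (fun e _ => φ.toEquiv e) ?_ ?_ ?_
  · intro e he
    simp only [outEdges, Set.Finite.mem_toFinset, Set.mem_ofPred_eq] at he ⊢
    rw [φ.src_apply, he]
  · exact fun a _ b _ h => φ.toEquiv.injective h
  · intro b hb
    simp only [outEdges, Set.Finite.mem_toFinset, Set.mem_ofPred_eq] at hb ⊢
    refine ⟨φ.toEquiv.symm b, g.injective ?_, by simp⟩
    rw [← φ.src_apply, Equiv.apply_symm_apply, hb]

theorem qE_apply (e f : E) : G.qE (φ.toEquiv e) (φ.toEquiv f) = G.qE e f := by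
  by_cases h : G.Follows e f <;> simp [qE, φ.follows_iff, φ.tgt_apply, φ.deg_apply, h]

theorem qEStep_apply (n : ℕ) (e f : E) :
    G.qEStep n (φ.toEquiv e) (φ.toEquiv f) = G.qEStep n e f := by
  induction n generalizing e with
  | zero =>
    by_cases h : e = f <;> simp [qEStep, h]
  | succ n ih =>
    simp only [qEStep]
    rw [← φ.toEquiv.tsum_eq]
    exact tsum_congr fun a => by rw [φ.qE_apply, ih]

theorem isCycle (φ : EdgeLift G g) {n : ℕ} {c : ℕ → E} (h : G.IsCycle n c) :
    G.IsCycle n fun k => φ.toEquiv (c k) := by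
  refine ⟨h.1, congrArg _ h.2.1, ?_, fun k hk => (φ.follows_iff _ _).2 (h.2.2.2 k hk)⟩
  intro i hi j hj hij
  simp only [φ.src_apply] at hij
  exact h.2.2.1 hi hj (g.injective hij)

theorem near (φ : EdgeLift G g) {n : ℕ} {x y : V} (h : G.Near n x y) : G.Near n (g x) (g y) := by
  induction h with
  | refl => exact .refl _ _
  | head ha _ ih =>
    obtain ⟨e, rfl, rfl⟩ := ha
    exact .head ⟨φ.toEquiv e, φ.src_apply e, φ.tgt_apply e⟩ ih

end EdgeLift

/-- Two fixed-point-free involutions of finite sets of equal cardinality are conjugate. -/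
theorem exists_equiv_conj {α β : Type*} [Finite α] [Finite β] (hcard : Nat.card α = Nat.card β)
    {σ : α → α} {τ : β → β} (hσ : ∀ a, σ (σ a) = a) (hσ' : ∀ a, σ a ≠ a)
    (hτ : ∀ b, τ (τ b) = b) (hτ' : ∀ b, τ b ≠ b) : ∃ φ : α ≃ β, ∀ a, φ (σ a) = τ (φ a) := by
  classical
  have := Fintype.ofFinite α
  have := Fintype.ofFinite β
  obtain ⟨ψ⟩ : Nonempty (α ≃ β) := Finite.card_eq.1 hcard
  let s : Equiv.Perm α := ⟨σ, σ, hσ, hσ⟩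
  let t : Equiv.Perm α := ⟨fun a => ψ.symm (τ (ψ a)), fun a => ψ.symm (τ (ψ a)),
    fun a => by simp [hτ], fun a => by simp [hτ]⟩
  -- A fixed-point-free involution is a product of transpositions that moves everything, so its
  -- cycle type depends only on the cardinality.
  have hct : ∀ p : Equiv.Perm α, (∀ a, p (p a) = a) → (∀ a, p a ≠ a) →
      p.cycleType = Multiset.replicate (Fintype.card α / 2) 2 := by
    intro p hp hp'
    have h2 : ∀ m ∈ p.cycleType, m = 2 := by
      intro m hm
      have h1 : p ^ 2 = 1 := by ext a; simp [pow_two, hp]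
      have h3 : m ∣ 2 := (Equiv.Perm.dvd_of_mem_cycleType hm).trans (orderOf_dvd_of_pow_eq_one h1)
      have h4 := Equiv.Perm.two_le_of_mem_cycleType hm
      exact le_antisymm (Nat.le_of_dvd two_pos h3) h4
    have h5 := Multiset.eq_replicate_card.2 h2
    have h6 := p.sum_cycleType
    have h7 : p.support = Finset.univ := by
      ext a; simp [hp']
    rw [h5, Multiset.sum_replicate, h7, Finset.card_univ, smul_eq_mul] at h6
    rw [h5, ← h6, Nat.mul_div_cancel _ two_pos]
  obtain ⟨c, hc⟩ := isConj_iff.1 (Equiv.Perm.isConj_iff_cycleType_eq.2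
    ((hct s hσ hσ').trans (hct t (fun a => by simp [t, hτ]) fun a h => hτ' (ψ a) (by
      have : ψ.symm (τ (ψ a)) = a := h
      rw [Equiv.symm_apply_eq] at this
      exact this)).symm))
  refine ⟨c.trans ψ, fun a => ?_⟩
  have h1 : c (s a) = t (c a) := by
    rw [← hc]; simp
  have h2 : c (σ a) = ψ.symm (τ (ψ (c a))) := h1
  simp [h2]

end LFGraph

namespace LFGraph

variable {V E : Type*} {G : LFGraph V E}

/-- The edges from `x` to `y`. -/
abbrev EdgesBetween (G : LFGraph V E) (x y : V) := {e // G.src e = x ∧ G.tgt e = y}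

instance finite_edgesBetween (x y : V) : Finite (G.EdgesBetween x y) :=
  ((G.finite_src x).subset (fun _ h => h.1 : {e | G.src e = x ∧ G.tgt e = y} ⊆ _)).to_subtype

/-- Reversal of the edges between two vertices. -/
def revEquiv (G : LFGraph V E) (x y : V) : G.EdgesBetween x y ≃ G.EdgesBetween y x where
  toFun e := ⟨G.rev e.1, e.2.2, (G.tgt_rev _).trans e.2.1⟩
  invFun e := ⟨G.rev e.1, e.2.2, (G.tgt_rev _).trans e.2.1⟩
  left_inv _ := Subtype.ext (G.rev_rev _)
  right_inv _ := Subtype.ext (G.rev_rev _)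

/-- Equal multiplicities give bijections between edge sets; the point is compatibility with
reversal. Between distinct vertices, a bijection is chosen in one direction and transported to the
other. For loops, reversal is a fixed-point-free involution, and `exists_equiv_conj` applies. -/
theorem exists_edgeLift {g : Equiv.Perm V} (hg : g ∈ G.autGroup) : Nonempty (G.EdgeLift g) := by
  classical
  have hcard : ∀ x y, Nat.card (G.EdgesBetween x y) = Nat.card (G.EdgesBetween (g x) (g y)) :=
    fun x y => (hg x y).symm
  have hex : ∀ x y, ∃ φ : G.EdgesBetween x y ≃ G.EdgesBetween (g x) (g y),
      x = y → ∀ a b : G.EdgesBetween x y, b.1 = G.rev a.1 → (φ b).1 = G.rev (φ a).1 := by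
    intro x y
    by_cases hxy : x = y
    · subst hxy
      obtain ⟨φ, hφ⟩ := exists_equiv_conj (hcard x x) (σ := G.revEquiv x x)
        (τ := G.revEquiv (g x) (g x)) (G.revEquiv x x).left_inv
        (fun a h => G.rev_ne a.1 (congrArg Subtype.val h)) (G.revEquiv (g x) (g x)).left_inv
        (fun a h => G.rev_ne a.1 (congrArg Subtype.val h))
      refine ⟨φ, fun _ a b hab => ?_⟩
      obtain rfl : b = G.revEquiv x x a := Subtype.ext hab
      rw [hφ]
      rfl
    · obtain ⟨φ⟩ := Finite.card_eq.1 (hcard x y)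
      exact ⟨φ, fun h => absurd h hxy⟩
  choose Ψ hΨ using hex
  -- An arbitrary order serves only to select one direction for each pair of vertices.
  let _ : LinearOrder V := linearOrderOfSTO WellOrderingRel
  let Φ : ∀ x y, G.EdgesBetween x y ≃ G.EdgesBetween (g x) (g y) := fun x y =>
    if x ≤ y then Ψ x y
    else (G.revEquiv x y).trans ((Ψ y x).trans (G.revEquiv (g y) (g x)))
  have hΦ : ∀ x y a, (Φ y x (G.revEquiv x y a)).1 = G.rev (Φ x y a).1 := by
    intro x y a
    rcases lt_trichotomy x y with h | h | h
    · simp only [Φ, if_neg (not_le.2 h), if_pos h.le]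
      have : G.revEquiv y x (G.revEquiv x y a) = a := (G.revEquiv x y).left_inv a
      simp only [Equiv.trans_apply, this]
      rfl
    · subst h
      simp only [Φ, le_refl, if_true]
      exact hΨ x x rfl a _ rfl
    · simp only [Φ, if_neg (not_le.2 h), if_pos h.le]
      exact (G.rev_rev _).symm
  let F : E → E := fun e => (Φ (G.src e) (G.tgt e) ⟨e, rfl, rfl⟩).1
  have hF : ∀ x y (a : G.EdgesBetween x y), F a.1 = (Φ x y a).1 := by
    rintro x y ⟨e, rfl, rfl⟩
    rfl
  have hsrc : ∀ e, G.src (F e) = g (G.src e) := fun e => (Φ _ _ _).2.1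
  have htgt : ∀ e, G.tgt (F e) = g (G.tgt e) := fun e => (Φ _ _ _).2.2
  have hbij : Function.Bijective F := by
    constructor
    · intro e f hef
      have h1 : G.src e = G.src f := g.injective (by rw [← hsrc, ← hsrc, hef])
      have h2 : G.tgt e = G.tgt f := g.injective (by rw [← htgt, ← htgt, hef])
      have h3 := hF (G.src f) (G.tgt f) ⟨e, h1, h2⟩
      have h4 := hF (G.src f) (G.tgt f) ⟨f, rfl, rfl⟩
      have h5 := (Φ (G.src f) (G.tgt f)).injective (Subtype.ext (h3.symm.trans (hef.trans h4)))
      exact congrArg Subtype.val h5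
    · intro f
      let b : G.EdgesBetween (g (g.symm (G.src f))) (g (g.symm (G.tgt f))) :=
        ⟨f, (g.apply_symm_apply _).symm, (g.apply_symm_apply _).symm⟩
      refine ⟨((Φ _ _).symm b).1, (hF _ _ _).trans ?_⟩
      exact congrArg Subtype.val ((Φ _ _).apply_symm_apply b)
  refine ⟨⟨Equiv.ofBijective F hbij, hsrc, fun e => ?_⟩⟩
  have h := hΦ (G.src e) (G.tgt e) ⟨e, rfl, rfl⟩
  rw [← hF] at h
  exact h.symm

/-- `D` is the largest of the chosen distance bounds from the finitely many orbit representatives to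
the given cycle; lifted automorphisms carry the cycle close to any other vertex. -/
theorem exists_cycle_near (hconn : G.Connected) (htrans : G.AlmostTransitive) {n : ℕ} {c : ℕ → E}
    (hc : G.IsCycle n c) : ∃ D, ∀ x, ∃ c : ℕ → E, G.IsCycle n c ∧ G.Near D x (G.src (c 0)) := by
  have : Finite (MulAction.orbitRel.Quotient G.autGroup V) := htrans
  have := Fintype.ofFinite (MulAction.orbitRel.Quotient G.autGroup V)
  choose d hd using fun x => exists_near (G := G) hconn x (G.src (c 0))
  let _ := MulAction.orbitRel G.autGroup V
  let rep : MulAction.orbitRel.Quotient G.autGroup V → V := fun ω => Quotient.out ω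
  refine ⟨Finset.univ.sup fun ω => d (rep ω), fun x => ?_⟩
  have hx : MulAction.orbitRel G.autGroup V x (rep (Quotient.mk (MulAction.orbitRel G.autGroup V) x)) :=
    Setoid.symm (Quotient.mk_out (s := MulAction.orbitRel G.autGroup V) x)
  obtain ⟨⟨g, hg⟩, hgx⟩ := hx
  obtain ⟨φ⟩ := exists_edgeLift hg
  refine ⟨_, φ.isCycle hc, ?_⟩
  have h1 := φ.near (hd (rep (Quotient.mk (MulAction.orbitRel G.autGroup V) x)))
  have h2 : g (rep (Quotient.mk (MulAction.orbitRel G.autGroup V) x)) = x := hgx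
  rw [h2, ← φ.src_apply] at h1
  exact h1.mono (Finset.le_sup (f := fun ω => d (rep ω)) (Finset.mem_univ _))

theorem exists_src_eq (hdeg : ∀ x, 2 ≤ G.deg x) (x : V) : ∃ e, G.src e = x := by
  have hpos : 0 < (G.outEdges x).card := two_pos.trans_le (hdeg x)
  obtain ⟨e, he⟩ := Finset.card_pos.1 hpos
  exact ⟨e, by simpa [outEdges] using he⟩

theorem exists_infinite_edge_orbit (hinf : Infinite V) (hdeg : ∀ x, 2 ≤ G.deg x)
    (htrans : G.AlmostTransitive) :
    ∃ o, {f | ∀ n, G.qEStep n f f = G.qEStep n o o}.Infinite := by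
  have : Finite (MulAction.orbitRel.Quotient G.autGroup V) := htrans
  obtain ⟨ω, hω⟩ := Finite.exists_infinite_fiber
    (fun x : V => (Quotient.mk (MulAction.orbitRel G.autGroup V) x : MulAction.orbitRel.Quotient G.autGroup V))
  have hω' := Set.infinite_coe_iff.1 hω
  obtain ⟨x, hx⟩ := hω'.nonempty
  obtain ⟨o, ho⟩ := exists_src_eq hdeg x
  refine ⟨o, fun hfin => hω' ((hfin.image G.src).subset fun y hy => ?_)⟩
  have hyx : MulAction.orbitRel G.autGroup V y x := Quotient.exact (Eq.trans hy (Eq.symm hx))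
  obtain ⟨⟨g, hg⟩, hgx⟩ := hyx
  obtain ⟨φ⟩ := exists_edgeLift hg
  refine ⟨φ.toEquiv o, fun n => φ.qEStep_apply n o o, ?_⟩
  rw [φ.src_apply, ho]
  exact hgx

/-! ### Trees -/

/-- A closed non-backtracking path contains a cycle. -/
theorem exists_cycle_of_closed {n : ℕ} (hn : 0 < n) {c : ℕ → E}
    (hc : ∀ k, k + 1 < n → G.Follows (c k) (c (k + 1)))
    (hclosed : G.tgt (c (n - 1)) = G.src (c 0)) : ∃ m c, G.IsCycle m c := by
  classical
  -- The value at `n` is the starting vertex again, so that closing up becomes `v 0 = v n`. The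
  -- cycle is cut out at the shortest gap `m` between two equal values of `v`.
  let v : ℕ → V := fun k => if k < n then G.src (c k) else G.src (c 0)
  have htgt : ∀ k < n, G.tgt (c k) = v (k + 1) := by
    intro k hk
    by_cases h : k + 1 < n
    · simp only [v, if_pos h, (hc k h).1]
    · obtain rfl : k = n - 1 := by omega
      simp only [v, if_neg h, hclosed]
  have hsrc : ∀ k < n, G.src (c k) = v k := fun k hk => by simp only [v, if_pos hk]
  have hex : ∃ m, 0 < m ∧ ∃ i, i + m ≤ n ∧ v i = v (i + m) :=
    ⟨n, hn, 0, by omega, by simp [v]⟩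
  obtain ⟨hm, i, him, hv⟩ := Nat.find_spec hex
  have hmin := fun m' (h : m' < Nat.find hex) => Nat.find_min hex h
  set m := Nat.find hex
  -- A backtracking at the closing point contradicts `rev_ne` if `m = 1` and `Follows` if `m = 2`;
  -- otherwise stripping both end edges gives the shorter gap `m - 2`.
  have hnot : c i ≠ G.rev (c (i + m - 1)) := by
    intro h
    by_cases h1 : m = 1
    · rw [h1] at h
      exact G.rev_ne _ h.symm
    by_cases h2 : m = 2
    · rw [h2] at h
      refine (hc i (by omega)).2 ?_
      rw [h, G.rev_rev]
      rfl
    · refine hmin (m - 2) (by omega) ⟨by omega, i + 1, by omega, ?_⟩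
      rw [← htgt i (by omega), h, tgt_rev, hsrc _ (by omega)]
      congr 1
      omega
  refine ⟨m, fun k => if k < m then c (i + k) else c i, hm, by simp [hm], ?_, ?_⟩
  · have key : ∀ a b, a < b → b < m → v (i + a) ≠ v (i + b) := by
      intro a b hab hb h
      refine hmin (b - a) (by omega) ⟨by omega, i + a, by omega, ?_⟩
      rw [h]
      congr 1
      omega
    intro a ha b hb hab
    simp only [Set.mem_Iio] at ha hb
    simp only [if_pos ha, if_pos hb] at hab
    rw [hsrc _ (by omega), hsrc _ (by omega)] at hab
    rcases lt_trichotomy a b with h | h | h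
    · exact absurd hab (key a b h hb)
    · exact h
    · exact absurd hab.symm (key b a h ha)
  · intro k hk
    by_cases h : k + 1 < m
    · simp only [if_pos hk, if_pos h]
      exact hc (i + k) (by omega)
    · have hk1 : i + k = i + m - 1 := by omega
      simp only [if_pos hk, if_neg h, hk1]
      refine ⟨?_, hnot⟩
      rw [hsrc i (by omega), hv, htgt _ (by omega)]
      congr 1
      omega

theorem exists_cycle_of_isChain {l : List E} (hl : l.IsChain G.Follows) (hne : l ≠ [])
    (h : G.tgt (l.getLast hne) = G.src (l.head hne)) : ∃ m c, G.IsCycle m c := by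
  have hpos : 0 < l.length := List.length_pos_of_ne_nil hne
  refine exists_cycle_of_closed (n := l.length) hpos
    (c := fun k => l.getD k (l.head hne)) (fun k hk => ?_) ?_
  · have := List.isChain_iff_getElem.1 hl k hk
    rwa [← List.getD_eq_getElem _ (l.head hne) hk,
      ← List.getD_eq_getElem _ (l.head hne) (Nat.lt_of_succ_lt hk)] at this
  · rw [List.getD_eq_getElem _ _ (Nat.sub_lt hpos one_pos), List.getD_eq_getElem _ _ hpos]
    rw [← List.getLast_eq_getElem, ← List.head_eq_getElem_zero]
    exact h

/-- `G.IsPath x l y`: the edges in `l` form a path from `x` to `y`. -/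
def IsPath (G : LFGraph V E) : V → List E → V → Prop
  | x, [], y => x = y
  | x, a :: l, y => G.src a = x ∧ IsPath G (G.tgt a) l y

theorem IsPath.append {x y z : V} {l l' : List E} (h : G.IsPath x l y) (h' : G.IsPath y l' z) :
    G.IsPath x (l ++ l') z := by
  induction l generalizing x with
  | nil => obtain rfl : x = y := h; exact h'
  | cons a l ih => exact ⟨h.1, ih h.2⟩

theorem IsPath.reverse {x y : V} {l : List E} (h : G.IsPath x l y) :
    G.IsPath y (l.reverse.map G.rev) x := by
  induction l generalizing x with
  | nil => exact Eq.symm h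
  | cons a l ih =>
    rw [List.reverse_cons, List.map_append]
    exact (ih h.2).append ⟨rfl, (G.tgt_rev a).trans h.1⟩

theorem IsPath.src_head {x y : V} {l : List E} (h : G.IsPath x l y) (hne : l ≠ []) :
    G.src (l.head hne) = x := by
  cases l with
  | nil => exact absurd rfl hne
  | cons a l => exact h.1

theorem IsPath.tgt_getLast {x y : V} {l : List E} (h : G.IsPath x l y) (hne : l ≠ []) :
    G.tgt (l.getLast hne) = y := by
  induction l generalizing x with
  | nil => exact absurd rfl hne
  | cons a l ih =>
    by_cases hl : l = []
    · subst hl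
      exact h.2
    · rw [List.getLast_cons hl]
      exact ih h.2 hl

theorem IsPath.eq_of_isTree (hT : G.IsTree) {x y : V} {l l' : List E} (h : G.IsPath x l y)
    (h' : G.IsPath x l' y) (hl : l.IsChain G.Follows) (hl' : l'.IsChain G.Follows) : l = l' := by
  have hclosed : ∀ (z : V) (l : List E), G.IsPath z l z → l.IsChain G.Follows → l = [] := by
    intro z l h hl
    by_contra hne
    obtain ⟨m, c, hc⟩ := exists_cycle_of_isChain hl hne
      ((h.tgt_getLast hne).trans (h.src_head hne).symm)
    exact hT.2 m c hc
  induction l generalizing x l' with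
  | nil =>
    obtain rfl : x = y := h
    exact (hclosed x l' h' hl').symm
  | cons a l ih =>
    cases l' with
    | nil =>
      obtain rfl : x = y := h'
      exact hclosed x _ h hl
    | cons b l' =>
      by_cases hab : a = b
      · subst hab
        rw [ih h.2 h'.2 hl.tail hl'.tail]
      · exfalso
        -- As the first edges differ, the reversal of one path followed by the other is a nonempty
        -- closed non-backtracking path.
        have hrev : ((b :: l').reverse.map G.rev).IsChain G.Follows := by
          rw [List.isChain_map, List.isChain_reverse]
          exact hl'.imp fun e f hef => Follows.rev G hef
        have hnil := hclosed y _ (h'.reverse.append h) (by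
          refine List.isChain_append.2 ⟨hrev, hl, ?_⟩
          intro e he f hf
          have he' : e = G.rev b := by simpa [eq_comm] using he
          have hf' : f = a := by simpa [eq_comm] using hf
          subst he' hf'
          refine ⟨?_, ?_⟩
          · rw [tgt_rev, h.1, h'.1]
          · rw [G.rev_rev]
            exact hab)
        simp at hnil

theorem exists_isPath_of_qEStep_ne_zero {n : ℕ} {e f : E} (h : G.qEStep n e f ≠ 0) :
    ∃ l : List E, l.length = n ∧ (e :: l).IsChain G.Follows ∧
      G.IsPath (G.src e) (e :: l) (G.tgt f) := by
  classical
  induction n generalizing e with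
  | zero =>
    have hef : e = f := by
      by_contra hne
      simp [qEStep, hne] at h
    subst hef
    exact ⟨[], rfl, by simp, rfl, rfl⟩
  | succ n ih =>
    obtain ⟨g, hg⟩ : ∃ g, G.qE e g * G.qEStep n g f ≠ 0 := by
      by_contra hno
      push Not at hno
      exact h (by simp [qEStep, hno])
    obtain ⟨l, hlen, hchain, hpath⟩ := ih (right_ne_zero_of_mul hg)
    have hfol : G.Follows e g := by
      by_contra hno
      exact left_ne_zero_of_mul hg (by simp [qE, hno])
    refine ⟨g :: l, by simp [hlen], List.isChain_cons_cons.2 ⟨hfol, hchain⟩, rfl, ?_⟩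
    rw [← hfol.1]
    exact hpath

theorem exists_isPath_of_q_ne_zero {n : ℕ} {x y : V} (h : G.q (n + 1) x y ≠ 0) :
    ∃ l : List E, l.length = n + 1 ∧ l.IsChain G.Follows ∧ G.IsPath x l y := by
  obtain ⟨e, he, h1⟩ := Finset.exists_ne_zero_of_sum_ne_zero h
  obtain ⟨f, hf, h2⟩ := Finset.exists_ne_zero_of_sum_ne_zero h1
  obtain ⟨l, hlen, hchain, hpath⟩ := exists_isPath_of_qEStep_ne_zero (right_ne_zero_of_mul h2)
  have he' : G.src e = x := by simpa [outEdges] using he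
  have hf' : G.tgt f = y := by simpa [inEdges] using hf
  rw [he', hf'] at hpath
  exact ⟨e :: l, by simp [hlen], hchain, hpath⟩

theorem eventually_q_eq_zero (hT : G.IsTree) (x y : V) : ∀ᶠ n : ℕ in atTop, G.q n x y = 0 := by
  by_cases h : ∃ N, G.q (N + 1) x y ≠ 0
  · obtain ⟨N, hN⟩ := h
    obtain ⟨l, hlen, hl, hp⟩ := exists_isPath_of_q_ne_zero hN
    filter_upwards [eventually_gt_atTop (N + 1)] with n hn
    by_contra hne
    obtain ⟨k, rfl⟩ : ∃ k, n = k + 1 := ⟨n - 1, by omega⟩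
    obtain ⟨l', hlen', hl', hp'⟩ := exists_isPath_of_q_ne_zero hne
    rw [hp.eq_of_isTree hT hp' hl hl', hlen'] at hlen
    omega
  · push Not at h
    filter_upwards [eventually_gt_atTop 0] with n hn
    obtain ⟨k, rfl⟩ : ∃ k, n = k + 1 := ⟨n - 1, by omega⟩
    exact h k

/-! ### The transition matrix -/

theorem qE_nonneg (hdeg : ∀ x, 2 ≤ G.deg x) (e f : E) : 0 ≤ G.qE e f := by
  unfold qE
  split_ifs
  · have : (2 : ℝ) ≤ G.deg (G.tgt e) := by exact_mod_cast hdeg _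
    exact one_div_nonneg.2 (by linarith)
  · exact le_rfl

theorem qE_pos (hdeg : ∀ x, 2 ≤ G.deg x) {e f : E} (h : G.Follows e f) : 0 < G.qE e f := by
  have : (2 : ℝ) ≤ G.deg (G.tgt e) := by exact_mod_cast hdeg _
  rw [qE, if_pos h]
  exact one_div_pos.2 (by linarith)

theorem qE_eq_zero {e f : E} (h : f ∉ G.outEdges (G.tgt e)) : G.qE e f = 0 :=
  if_neg fun hf => h (by simpa [outEdges] using hf.1)

theorem sum_qE_le_one (hdeg : ∀ x, 2 ≤ G.deg x) (e : E) :
    ∑ f ∈ G.outEdges (G.tgt e), G.qE e f ≤ 1 := by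
  classical
  have hd : (2 : ℝ) ≤ G.deg (G.tgt e) := by exact_mod_cast hdeg _
  have hmem : G.rev e ∈ G.outEdges (G.tgt e) := by simp [outEdges, src_rev]
  rw [← Finset.add_sum_erase _ _ hmem, qE, if_neg fun h => h.2 rfl, zero_add]
  calc _ ≤ ∑ f ∈ (G.outEdges (G.tgt e)).erase (G.rev e), 1 / ((G.deg (G.tgt e) : ℝ) - 1) := by
        refine Finset.sum_le_sum fun f _ => ?_
        unfold qE
        split_ifs
        · exact le_rfl
        · exact one_div_nonneg.2 (by linarith)
    _ = 1 := by
        rw [Finset.sum_const, Finset.card_erase_of_mem hmem, nsmul_eq_mul]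
        change (((G.deg (G.tgt e) - 1 : ℕ) : ℝ)) * _ = 1
        rw [Nat.cast_sub (by have := hdeg (G.tgt e); omega), Nat.cast_one]
        exact mul_one_div_cancel (by linarith)

/-- The transition matrix of the walk on the oriented edges. -/
noncomputable def edgeMatrix (G : LFGraph V E) (hdeg : ∀ x, 2 ≤ G.deg x) : RowFiniteMatrix E where
  entry := G.qE
  supp e := G.outEdges (G.tgt e)
  nonneg := qE_nonneg hdeg
  eq_zero _ _ := qE_eq_zero

theorem edgeMatrix_pow (hdeg : ∀ x, 2 ≤ G.deg x) (n : ℕ) (e f : E) :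
    (G.edgeMatrix hdeg).pow n e f = G.qEStep n e f := by
  induction n generalizing e with
  | zero => rfl
  | succ n ih =>
    rw [qEStep, tsum_eq_sum (s := G.outEdges (G.tgt e)) fun g hg => by
      rw [qE_eq_zero hg, zero_mul]]
    exact Finset.sum_congr rfl fun g _ => by rw [ih]; rfl

theorem qEStep_nonneg (hdeg : ∀ x, 2 ≤ G.deg x) (n : ℕ) (e f : E) : 0 ≤ G.qEStep n e f := by
  rw [← edgeMatrix_pow hdeg]
  exact RowFiniteMatrix.pow_nonneg _ n e f

theorem edgeMatrix_pow_le_one (hdeg : ∀ x, 2 ≤ G.deg x) (n : ℕ) (e f : E) :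
    (G.edgeMatrix hdeg).pow n e f ≤ 1 := by
  induction n generalizing e with
  | zero => unfold RowFiniteMatrix.pow; split_ifs <;> norm_num
  | succ n ih =>
    exact (Finset.sum_le_sum fun g _ => mul_le_of_le_one_right (qE_nonneg hdeg e g) (ih g)).trans
      (sum_qE_le_one hdeg e)

theorem q_nonneg (hdeg : ∀ x, 2 ≤ G.deg x) (n : ℕ) (x y : V) : 0 ≤ G.q n x y := by
  cases n with
  | zero =>
    by_cases h : x = y <;> simp [q, h]
  | succ n =>
    exact Finset.sum_nonneg fun e _ => Finset.sum_nonneg fun f _ =>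
      mul_nonneg (by positivity) (qEStep_nonneg hdeg n e f)

theorem qEStep_le_q (hdeg : ∀ x, 2 ≤ G.deg x) (n : ℕ) {x y : V} {e f : E} (he : G.src e = x)
    (hf : G.tgt f = y) : 1 / (G.deg x : ℝ) * G.qEStep n e f ≤ G.q (n + 1) x y := by
  have h0 : ∀ e f, 0 ≤ 1 / (G.deg x : ℝ) * G.qEStep n e f := fun e f =>
    mul_nonneg (by positivity) (qEStep_nonneg hdeg n e f)
  refine (Finset.single_le_sum (f := fun f => 1 / (G.deg x : ℝ) * G.qEStep n e f)
    (fun f _ => h0 e f) (show f ∈ G.inEdges y by simpa [inEdges] using hf)).trans ?_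
  exact Finset.single_le_sum
    (f := fun e => ∑ f ∈ G.inEdges y, 1 / (G.deg x : ℝ) * G.qEStep n e f)
    (fun e _ => Finset.sum_nonneg fun f _ => h0 e f)
    (show e ∈ G.outEdges x by simpa [outEdges] using he)

theorem edgeMatrix_irreducible (hinf : Infinite V) (hconn : G.Connected)
    (hdeg : ∀ x, 2 ≤ G.deg x) (htrans : G.AlmostTransitive) (hT : ¬ G.IsTree) :
    (G.edgeMatrix hdeg).Irreducible := by
  obtain ⟨n, c, hc⟩ : ∃ n c, G.IsCycle n c := by
    by_contra hno
    push Not at hno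
    exact hT ⟨hconn, hno⟩
  obtain ⟨D, hD⟩ := exists_cycle_near hconn htrans hc
  exact fun e f => (reach_of_reach_rev hconn (reach_rev hinf hconn hdeg hD) e f).lift id
    fun a b hab => qE_pos hdeg hab

theorem exists_rate_of_not_isTree (hinf : Infinite V) (hconn : G.Connected)
    (hdeg : ∀ x, 2 ≤ G.deg x) (htrans : G.AlmostTransitive) (hT : ¬ G.IsTree) :
    ∃ ρ > 0, (∀ x y, G.rate x y = ρ) ∧
      ∀ x y, Tendsto (fun n : ℕ => G.q n x y / ρ ^ n) atTop (𝓝 0) := by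
  have hirr := edgeMatrix_irreducible hinf hconn hdeg htrans hT
  obtain ⟨o, ho⟩ := exists_infinite_edge_orbit hinf hdeg htrans
  obtain ⟨ρ, hρ, hlim, hlow⟩ := RowFiniteMatrix.exists_spectral_radius (G.edgeMatrix hdeg) hirr
    (G.rev_ne o).symm (fun n => edgeMatrix_pow_le_one hdeg n o o)
    (by simpa only [edgeMatrix_pow] using ho)
  have hq : ∀ x y, Tendsto (fun n : ℕ => G.q n x y / ρ ^ n) atTop (𝓝 0) := by
    intro x y
    rw [← tendsto_add_atTop_iff_nat 1]
    have h : Tendsto (fun n => ∑ e ∈ G.outEdges x, ∑ f ∈ G.inEdges y,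
        1 / (G.deg x : ℝ) / ρ * (G.qEStep n e f / ρ ^ n)) atTop
        (𝓝 (∑ e ∈ G.outEdges x, ∑ f ∈ G.inEdges y, 1 / (G.deg x : ℝ) / ρ * 0)) :=
      tendsto_finsetSum _ fun e _ => tendsto_finsetSum _ fun f _ =>
        ((hlim e f).congr fun n => by rw [edgeMatrix_pow]).const_mul _
    simp only [mul_zero, Finset.sum_const_zero] at h
    refine h.congr fun n => ?_
    simp only [q, Finset.sum_div]
    refine Finset.sum_congr rfl fun e _ => Finset.sum_congr rfl fun f _ => ?_
    rw [pow_succ]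
    ring
  refine ⟨ρ, hρ, fun x y => ?_, hq⟩
  refine limsup_rpow_one_div_eq hρ (fun n => q_nonneg hdeg n x y) (hq x y) fun r hr => ?_
  obtain ⟨m, hm, hpos, hrm⟩ := hlow r hr
  obtain ⟨e, he⟩ := exists_src_eq hdeg x
  obtain ⟨f, hf⟩ := exists_src_eq hdeg y
  obtain ⟨i, hi⟩ := RowFiniteMatrix.exists_pow_pos _ (hirr e o)
  obtain ⟨k, hk⟩ := RowFiniteMatrix.exists_pow_pos _ (hirr o (G.rev f))
  have hdx : (0 : ℝ) < G.deg x := by exact_mod_cast two_pos.trans_le (hdeg x)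
  -- Lower bound from the paths that go from `e` to `o`, make `j` returns of length `m` at `o`, and
  -- end with `G.rev f`, which points to `y`. The extra 1 in the offset is the first step out of
  -- `x`.
  refine ⟨1 / (G.deg x : ℝ) * ((G.edgeMatrix hdeg).pow i e o *
    (G.edgeMatrix hdeg).pow k o (G.rev f)), by positivity, i + k + 1, m, _, hpos, hm, hrm,
    fun j => ?_⟩
  rw [show j * m + (i + k + 1) = i + j * m + k + 1 by ring]
  refine le_trans ?_ (qEStep_le_q hdeg _ he ((G.tgt_rev f).trans hf))
  rw [mul_assoc, ← edgeMatrix_pow hdeg]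
  refine mul_le_mul_of_nonneg_left ?_ (by positivity)
  have h1 := mul_le_mul_of_nonneg_left ((G.edgeMatrix hdeg).pow_pow_le m j o) hi.le
  have h2 := h1.trans ((G.edgeMatrix hdeg).pow_mul_pow_le i (j * m) e o o)
  have h3 := (mul_le_mul_of_nonneg_right h2 hk.le).trans
    ((G.edgeMatrix hdeg).pow_mul_pow_le (i + j * m) k e (G.rev f) o)
  refine le_trans (le_of_eq ?_) h3
  ring

end LFGraph

theorem theorem1p4 {V E : Type*} (G : LFGraph V E) (hinf : Infinite V) (hconn : G.Connected)
    (hdeg : ∀ x, 2 ≤ G.deg x) (htrans : G.AlmostTransitive) :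
    ∃ ρ : ℝ, (∀ x y, G.rate x y = ρ) ∧
      (¬ G.IsTree → 0 < ρ) ∧
      (G.IsTree → ρ = 0 ∧ ∀ x y, ∀ᶠ n : ℕ in atTop, G.q n x y = 0) ∧
      ∀ x y, Tendsto (fun n : ℕ => G.q n x y / ρ ^ n) atTop (𝓝 0) := by
  by_cases hT : G.IsTree
  · have h0 := LFGraph.eventually_q_eq_zero hT
    refine ⟨0, fun x y => ?_, fun h => absurd hT h, fun _ => ⟨rfl, h0⟩, fun x y => ?_⟩
    · have h : (fun n : ℕ => G.q n x y ^ (1 / (n : ℝ))) =ᶠ[atTop] fun _ => (0 : ℝ) := by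
        filter_upwards [h0 x y, eventually_gt_atTop 0] with n hn hpos
        rw [hn, Real.zero_rpow (by positivity)]
      exact (limsup_congr h).trans (limsup_const 0)
    · refine tendsto_const_nhds.congr' ((h0 x y).mono fun n hn => ?_)
      simp only [hn, zero_div]
  · obtain ⟨ρ, hρ, hrate, hlim⟩ := LFGraph.exists_rate_of_not_isTree hinf hconn hdeg htrans hT
    exact ⟨ρ, hrate, fun _ => hρ, fun h => absurd h hT, hlim⟩
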